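/- For a positive integer $k$, color the nonnegative integers with $k$ colors $1,\dots,k$ and order the colored integers by $0_1\prec 0_2\prec\cdots\prec 0_k\prec 1_1\prec\cdots\prec 1_k\prec 2_1\prec\cdots$. A $k$-colored generalized Frobenius partition of $n$ is a two-row array $$\begin{pmatrix}a_1,a_2,\dots,a_r\\ b_1,b_2,\dots,b_r\end{pmatrix}\qquad(r\ge 0)$$ of colored nonnegative integers with $a_r\prec\cdots\prec a_1$, $b_r\prec\cdots\prec b_1$ and $n=r+\sum_{i=1}^r(a_i+b_i)$, where the sum is taken over the underlying integers. Let $c\phi_k(n)$ denote the number of $k$-colored generalized Frobenius partitions of $n$, with $c\phi_k(x)=0$ if $x$ is not a nonnegative integer. Then for every integer $n$, $$c\phi_9(n)=3\,c\phi_3(3n-1)+c\phi_3\left(\frac n3\right).$$ -/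

import Mathlib

/-- Nonnegative integers colored with `k` colors. The order is lexicographic: first the integer,
then the color, so that `0_1 ≺ ⋯ ≺ 0_k ≺ 1_1 ≺ ⋯ ≺ 1_k ≺ 2_1 ≺ ⋯`. -/
abbrev ColoredNat (k : ℕ) : Type := ℕ ×ₗ Fin k

/-- The nonnegative integer underlying a colored integer. -/
def ColoredNat.value {k : ℕ} (c : ColoredNat k) : ℕ := (ofLex c).1

/-- A `k`-colored generalized Frobenius partition: a two-row array of colored integers with rows
`a₁, …, a_r` and `b₁, …, b_r` of the same length (possibly zero), each row strictly decreasing. -/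
@[ext]
structure GenFrobeniusPartition (k : ℕ) where
  top : List (ColoredNat k)
  bottom : List (ColoredNat k)
  length_eq : top.length = bottom.length
  top_decreasing : top.Pairwise (fun x y => x > y)
  bottom_decreasing : bottom.Pairwise (fun x y => x > y)

/-- The number being partitioned, `r + ∑ (aᵢ + bᵢ)`. -/
def GenFrobeniusPartition.size {k : ℕ} (P : GenFrobeniusPartition k) : ℕ :=
  P.top.length + ((P.top.map ColoredNat.value).sum + (P.bottom.map ColoredNat.value).sum)

/-- `cφ_k(x)`: the number of `k`-colored generalized Frobenius partitions of `x`. The argument is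
a rational number; the count is zero unless `x` is a nonnegative integer. -/
noncomputable def cphi (k : ℕ) (x : ℚ) : ℕ :=
  Nat.card {P : GenFrobeniusPartition k // (P.size : ℚ) = x}

/-- The set counted by `cφ_k(x)` is finite. -/
theorem GenFrobeniusPartition.finite_size_eq (k : ℕ) (x : ℚ) :
    Finite {P : GenFrobeniusPartition k // (P.size : ℚ) = x} := by
  classical
  by_cases hx : ∃ m : ℕ, (m : ℚ) = x
  · obtain ⟨m, rfl⟩ := hx
    let B : Finset (ColoredNat k) :=
      (Finset.range (m + 1) ×ˢ (Finset.univ : Finset (Fin k))).map toLex.toEmbedding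
    have hB : ∀ c : ColoredNat k, c.value ≤ m → c ∈ B := by
      intro c hc
      refine Finset.mem_map.2 ⟨ofLex c, ?_, rfl⟩
      simpa [Nat.lt_succ_iff, ColoredNat.value] using hc
    have hle : ∀ (l : List (ColoredNat k)) (c : ColoredNat k), c ∈ l →
        c.value ≤ (l.map ColoredNat.value).sum := fun l c hc =>
      List.le_sum_of_mem (List.mem_map_of_mem hc)
    let f : {P : GenFrobeniusPartition k // (P.size : ℚ) = m} → B.powerset × B.powerset :=
      fun P => by
        have hs : P.1.size = m := by exact_mod_cast P.2
        unfold GenFrobeniusPartition.size at hs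
        refine (⟨P.1.top.toFinset, ?_⟩, ⟨P.1.bottom.toFinset, ?_⟩)
        · refine Finset.mem_powerset.2 fun c hc => hB c ?_
          have := hle _ c (List.mem_toFinset.1 hc)
          omega
        · refine Finset.mem_powerset.2 fun c hc => hB c ?_
          have := hle _ c (List.mem_toFinset.1 hc)
          omega
    have key : ∀ l l' : List (ColoredNat k), l.Pairwise (fun x y => x > y) →
        l'.Pairwise (fun x y => x > y) → l.toFinset = l'.toFinset → l = l' := by
      intro l l' h h' e
      have p := List.perm_of_nodup_nodup_toFinset_eq (h.imp fun h => h.ne')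
        (h'.imp fun h => h.ne') e
      exact p.eq_of_pairwise (fun a b _ _ hab hba => absurd hab (lt_asymm hba)) h h'
    refine Finite.of_injective f ?_
    rintro ⟨P, hP⟩ ⟨Q, hQ⟩ h
    have h1 := congrArg (fun t => (t.1 : Finset (ColoredNat k))) h
    have h2 := congrArg (fun t => (t.2 : Finset (ColoredNat k))) h
    exact Subtype.ext (GenFrobeniusPartition.ext
      (key _ _ P.top_decreasing Q.top_decreasing h1)
      (key _ _ P.bottom_decreasing Q.bottom_decreasing h2))
  · have : IsEmpty {P : GenFrobeniusPartition k // (P.size : ℚ) = x} :=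
      ⟨fun P => hx ⟨P.1.size, P.2⟩⟩
    infer_instance

/-! Write P, a, C for `neutralSeries`, `thetaA`, `coreSeries`; P is the partition series, since
neutral states are Frobenius symbols. Separating the charges of the colours shows that cφ_k has
generating series Θ_k P^k, with Θ_k the theta series of the root lattice A_{k-1} (`genSeries_size`),
and Θ_3 = a.

Four identities, obtained from bijections of lattices and states, carry the rest: P = C P(q³)³
(`neutralSeries_eq`); a = a(q³) + 6q C(q³) (`thetaA_dissection`); C³ = C(q³)(a(q³)² + 3q a(q³)C(q³)
+ 9q² C(q³)²) (`coreSeries_cubed'`); Θ_9 = a³ a(q³) + 54q a C³ + 162q² C(q³)C³ (`rootTheta_nine`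
with `thetaC_eq`).

The first three split a P³ by exponents modulo 3, and the part with exponents 3m+2 comes from 27
P⁹C³a. Put b = a(q³) - 3q C(q³). The second and third give a³ - 27q C³ = b³, and moreover P³b =
P(q³) (`neutralSeries_cubed_mul`), so P(q³)³ = P⁹(a³ - 27q C³). Subtracting a(q³)P(q³)³, the series
of cφ_3(n/3), from Θ_9 P⁹ leaves 27q C³P⁹(a(q³) + 2a + 6q C(q³)) = 81q a C³P⁹, three times the
series of cφ_3(3n-1). -/

open PowerSeries

namespace FrobeniusSeries

/-! ### Generating series of weighted types -/

/-- The generating series of a type with respect to an integer weight. -/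
noncomputable def genSeries {α : Type*} (w : α → ℤ) : ℤ⟦X⟧ :=
  PowerSeries.mk fun n => (Nat.card {a // w a = n} : ℤ)

/-- A weight is admissible if it is nonnegative and takes each value finitely often. -/
structure Admissible {α : Type*} (w : α → ℤ) : Prop where
  nonneg : ∀ a, 0 ≤ w a
  finite : ∀ n : ℤ, Finite {a // w a = n}

section Basic

variable {α β γ : Type*}

theorem genSeries_equiv (e : α ≃ β) {w : α → ℤ} {v : β → ℤ} (h : ∀ a, v (e a) = w a) :
    genSeries w = genSeries v := by
  ext n
  simp only [genSeries, coeff_mk]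
  congr 1
  exact Nat.card_congr (e.subtypeEquiv fun a => by rw [h])

theorem genSeries_bijective (f : α → β) (hi : Function.Injective f) (hs : Function.Surjective f)
    {w : α → ℤ} {v : β → ℤ} (h : ∀ a, v (f a) = w a) : genSeries w = genSeries v :=
  genSeries_equiv (Equiv.ofBijective f ⟨hi, hs⟩) h

theorem Admissible.comp {w : α → ℤ} (hw : Admissible w) {f : β → α}
    (hf : Function.Injective f) : Admissible fun b => w (f b) := by
  refine ⟨fun b => hw.nonneg _, fun n => ?_⟩
  have := hw.finite n
  refine Finite.of_injective (fun b : {b // w (f b) = n} => (⟨f b.1, b.2⟩ : {a // w a = n})) ?_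
  intro b b' h
  exact Subtype.ext (hf (congrArg Subtype.val h))

/-- A value w ≤ -1 would give c + d w ≤ c - d < 0; this is where c < d enters. -/
theorem Admissible.of_affine {w : α → ℤ} {v : β → ℤ} (hv : Admissible v) {f : α → β}
    (hf : Function.Injective f) (c d : ℤ) (hd : 0 < d) (hcd : c < d)
    (h : ∀ a, v (f a) = c + d * w a) : Admissible w := by
  refine ⟨fun a => ?_, fun n => ?_⟩
  · by_contra! hlt
    have h1 := hv.nonneg (f a)
    rw [h] at h1
    nlinarith
  · have := (hv.comp hf).finite (c + d * n)
    refine Finite.of_injective (fun a : {a // w a = n} =>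
      (⟨a.1, by rw [h, a.2]⟩ : {a // v (f a) = c + d * n})) ?_
    intro a a' h'
    exact Subtype.ext (congrArg (fun t => t.1) h')

theorem Admissible.add {w : α → ℤ} {v : β → ℤ} (hw : Admissible w) (hv : Admissible v) :
    Admissible fun p : α × β => w p.1 + v p.2 := by
  refine ⟨fun p => add_nonneg (hw.nonneg _) (hv.nonneg _), fun n => ?_⟩
  have h1 : ∀ i : Finset.Icc 0 n, Finite {a // w a = i} := fun i => hw.finite _
  have h2 : ∀ i : Finset.Icc 0 n, Finite {b // v b = i} := fun i => hv.finite _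
  refine Finite.of_injective (fun p : {p : α × β // w p.1 + v p.2 = n} =>
    ((⟨⟨w p.1.1, ?_⟩, p.1.1, rfl⟩, ⟨⟨v p.1.2, ?_⟩, p.1.2, rfl⟩) :
      (Σ i : Finset.Icc 0 n, {a // w a = i}) × (Σ i : Finset.Icc 0 n, {b // v b = i}))) ?_
  · have := p.2; have := hw.nonneg p.1.1; have := hv.nonneg p.1.2
    rw [Finset.mem_Icc]; omega
  · have := p.2; have := hw.nonneg p.1.1; have := hv.nonneg p.1.2
    rw [Finset.mem_Icc]; omega
  · intro p q h
    have e1 := congrArg (fun t => (t.1.2 : α)) h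
    have e2 := congrArg (fun t => (t.2.2 : β)) h
    exact Subtype.ext (Prod.ext e1 e2)

theorem genSeries_mul {w : α → ℤ} {v : β → ℤ} (hw : Admissible w) (hv : Admissible v) :
    genSeries (fun p : α × β => w p.1 + v p.2) = genSeries w * genSeries v := by
  classical
  ext n
  rw [coeff_mul]
  simp only [genSeries, coeff_mk]
  have e : {p : α × β // w p.1 + v p.2 = n} ≃
      Σ i : Finset.HasAntidiagonal.antidiagonal n, {a // w a = i.1.1} × {b // v b = i.1.2} :=
    { toFun := fun p => ⟨⟨((w p.1.1).toNat, (v p.1.2).toNat), by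
          have := p.2; have := hw.nonneg p.1.1; have := hv.nonneg p.1.2
          rw [Finset.HasAntidiagonal.mem_antidiagonal]; omega⟩,
        ⟨p.1.1, (Int.toNat_of_nonneg (hw.nonneg _)).symm⟩,
        ⟨p.1.2, (Int.toNat_of_nonneg (hv.nonneg _)).symm⟩⟩
      invFun := fun q => ⟨(q.2.1.1, q.2.2.1), by
        have h1 := q.2.1.2
        have h2 := q.2.2.2
        have h3 := Finset.HasAntidiagonal.mem_antidiagonal.1 q.1.2
        simp only [h1, h2]
        exact_mod_cast h3⟩
      left_inv := fun p => rfl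
      right_inv := by
        rintro ⟨⟨⟨i, j⟩, hij⟩, ⟨a, ha⟩, ⟨b, hb⟩⟩
        simp only at ha hb
        obtain rfl : i = (w a).toNat := by omega
        obtain rfl : j = (v b).toNat := by omega
        rfl }
  have h1 : ∀ i : ℤ, Finite {a // w a = i} := hw.finite
  have h2 : ∀ i : ℤ, Finite {b // v b = i} := hv.finite
  rw [Nat.card_congr e, Nat.card_sigma]
  simp only [Nat.card_prod]
  push_cast
  exact Finset.sum_coe_sort (Finset.HasAntidiagonal.antidiagonal n)
    (fun i => (Nat.card {a // w a = i.1} : ℤ) * (Nat.card {b // v b = i.2} : ℤ))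

theorem genSeries_cover {ι : Type*} [Fintype ι] {β : ι → Type*} {w : α → ℤ} (hw : Admissible w)
    (f : ∀ i, β i → α) (hf : ∀ i, Function.Injective (f i)) (c : α → ι)
    (hc : ∀ i b, c (f i b) = i) (hs : ∀ a, ∃ b, f (c a) b = a) :
    genSeries w = ∑ i, genSeries fun b => w (f i b) := by
  ext n
  simp only [map_sum, genSeries, coeff_mk]
  have hfin : ∀ i, Finite {b // w (f i b) = n} := fun i => (hw.comp (hf i)).finite n
  rw [← Nat.cast_sum, ← Nat.card_sigma]
  congr 1
  refine (Nat.card_congr (Equiv.ofBijective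
    (fun q : Σ i, {b // w (f i b) = (n : ℤ)} => (⟨f q.1 q.2.1, q.2.2⟩ : {a // w a = (n : ℤ)}))
    ⟨?_, ?_⟩)).symm
  · rintro ⟨i, b, hb⟩ ⟨j, d, hd⟩ h
    have h' : f i b = f j d := congrArg Subtype.val h
    obtain rfl : i = j := by rw [← hc i b, h', hc]
    obtain rfl := hf i h'
    rfl
  · rintro ⟨a, ha⟩
    obtain ⟨b, hb⟩ := hs a
    exact ⟨⟨c a, b, by rw [hb, ha]⟩, Subtype.ext hb⟩

/-- If a weight-preserving permutation cycles three classes, the total generating series is three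
times that of one class. -/
theorem genSeries_cycle {w : α → ℤ} (hw : Admissible w) (φ : α → α) (hφ : Function.Bijective φ)
    (hwφ : ∀ a, w (φ a) = w a) (κ : α → ZMod 3) (hκ : ∀ a, κ (φ a) = κ a + 1)
    (g : β → α) (hg : Function.Injective g) (hg0 : ∀ b, κ (g b) = 0)
    (hgs : ∀ a, κ a = 0 → ∃ b, g b = a) :
    genSeries w = 3 * genSeries fun b => w (g b) := by
  have hκi : ∀ (j : ℕ) a, κ (φ^[j] a) = κ a + j := by
    intro j
    induction j with
    | zero => intro a; simp
    | succ j ih => intro a; rw [Function.iterate_succ_apply', hκ, ih]; push_cast; ring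
  have hwi : ∀ (j : ℕ) a, w (φ^[j] a) = w a := by
    intro j
    induction j with
    | zero => intro a; simp
    | succ j ih => intro a; rw [Function.iterate_succ_apply', hwφ, ih]
  -- Each element is φ^i (g b) for exactly one i in {0, 1, 2}, read off from κ.
  have key := genSeries_cover (ι := ZMod 3) (β := fun _ => β) hw
    (fun i b => φ^[i.val] (g b)) (fun i => (hφ.injective.iterate _).comp hg) κ
    (fun i b => by rw [hκi, hg0, zero_add, ZMod.natCast_zmod_val]) (fun a => by
      obtain ⟨a', ha'⟩ := hφ.surjective.iterate (κ a).val a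
      have h0 : κ a' = 0 := by
        have := hκi (κ a).val a'
        rw [ha', ZMod.natCast_zmod_val] at this
        simpa using this
      obtain ⟨b, hb⟩ := hgs a' h0
      exact ⟨b, by simp only [hb, ha']⟩)
  rw [key]
  simp only [hwi, Finset.sum_const, Finset.card_univ, ZMod.card, nsmul_eq_mul]
  norm_num

theorem genSeries_const_add {w : α → ℤ} (hw : Admissible w) (m : ℕ) :
    genSeries (fun a => m + w a) = X ^ m * genSeries w := by
  ext n
  rw [coeff_X_pow_mul']
  simp only [genSeries, coeff_mk]
  split_ifs with h
  · congr 1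
    exact Nat.card_congr (Equiv.subtypeEquivRight fun a => by push_cast [h]; omega)
  · have : IsEmpty {a // (m : ℤ) + w a = n} := ⟨fun a => by
      have := a.2; have := hw.nonneg a.1; omega⟩
    simp

theorem genSeries_three_mul {w : α → ℤ} :
    genSeries (fun a => 3 * w a) = expand 3 three_ne_zero (genSeries w) := by
  ext n
  rw [coeff_expand]
  simp only [genSeries, coeff_mk]
  split_ifs with h
  · congr 1
    exact Nat.card_congr (Equiv.subtypeEquivRight fun a => by omega)
  · have : IsEmpty {a // 3 * w a = n} := ⟨fun a => by have := a.2; omega⟩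
    simp

theorem Admissible.three_mul {w : α → ℤ} (hw : Admissible w) : Admissible fun a => 3 * w a := by
  refine ⟨fun a => by have := hw.nonneg a; omega, fun n => ?_⟩
  have := hw.finite (n / 3)
  exact Finite.of_injective (fun a : {a // 3 * w a = n} =>
    (⟨a.1, by have := a.2; omega⟩ : {a // w a = n / 3}))
    fun a a' h => Subtype.ext (congrArg (fun t => t.1) h)

theorem Admissible.const_add {w : α → ℤ} (hw : Admissible w) (m : ℕ) :
    Admissible fun a => m + w a := by
  refine ⟨fun a => by have := hw.nonneg a; omega, fun n => ?_⟩
  have := hw.finite (n - m)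
  exact Finite.of_injective (fun a : {a // m + w a = n} =>
    (⟨a.1, by have := a.2; omega⟩ : {a // w a = n - m}))
    fun a a' h => Subtype.ext (congrArg (fun t => t.1) h)

theorem admissible_genSeries_pow {w : α → ℤ} (hw : Admissible w) (k : ℕ) :
    Admissible (fun f : Fin k → α => ∑ i, w (f i)) ∧
      genSeries (fun f : Fin k → α => ∑ i, w (f i)) = genSeries w ^ k := by
  induction k with
  | zero =>
    refine ⟨⟨fun f => by simp, fun n => inferInstance⟩, ?_⟩
    ext n
    rw [pow_zero, coeff_one]
    simp only [genSeries, coeff_mk, Finset.univ_eq_empty, Finset.sum_empty]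
    split_ifs with h
    · subst h
      simp
    · have : IsEmpty {a : Fin 0 → α // (0 : ℤ) = n} := ⟨fun a => by have := a.2; omega⟩
      simp
  | succ k ih =>
    have h : ∀ p : α × (Fin k → α),
        ∑ i, w (Fin.consEquiv (fun _ => α) p i) = w p.1 + ∑ i, w (p.2 i) := by
      intro p
      rw [Fin.sum_univ_succ]
      simp [Fin.consEquiv]
    constructor
    · have := (hw.add ih.1).comp (Fin.consEquiv (fun _ : Fin (k + 1) => α)).symm.injective
      refine (funext fun f => ?_ : _ = fun f : Fin (k + 1) → α => ∑ i, w (f i)) ▸ this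
      rw [← h, Equiv.apply_symm_apply]
    · rw [← genSeries_equiv (Fin.consEquiv (fun _ : Fin (k + 1) => α)) h,
        genSeries_mul hw ih.1, ih.2, pow_succ']

end Basic

/-! ### Theta series of the Eisenstein lattice -/

/-- The norm form `m² - mn + n²` of the Eisenstein integers. -/
def eisNorm (p : ℤ × ℤ) : ℤ := p.1 ^ 2 - p.1 * p.2 + p.2 ^ 2

theorem admissible_eisNorm : Admissible eisNorm := by
  refine ⟨fun p => ?_, fun n => ?_⟩
  · unfold eisNorm; nlinarith [sq_nonneg (p.1 - p.2), sq_nonneg p.1, sq_nonneg p.2]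
  · have key : {p : ℤ × ℤ | eisNorm p = n} ⊆
        Set.Icc (-(2 * n + 1)) (2 * n + 1) ×ˢ Set.Icc (-(2 * n + 1)) (2 * n + 1) := by
      rintro ⟨x, y⟩ h
      simp only [Set.mem_ofPred_eq, eisNorm] at h
      simp only [Set.mem_prod, Set.mem_Icc]
      refine ⟨⟨?_, ?_⟩, ?_, ?_⟩ <;>
        nlinarith [sq_nonneg (x - y), sq_nonneg (x + 1), sq_nonneg (y + 1), sq_nonneg (x - 1),
          sq_nonneg (y - 1)]
    exact ((Set.finite_Icc _ _).prod (Set.finite_Icc _ _)).subset key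

/-- The exponent of the theta series of a nontrivial coset of the Eisenstein lattice. -/
def cosetNorm (p : ℤ × ℤ) : ℤ := eisNorm p + (p.1 - p.2)

/-- The exponent of the generating series of 3-cores. -/
def coreNorm (p : ℤ × ℤ) : ℤ := 3 * eisNorm p + (2 * p.1 - p.2)

/-- Read (m, n) as m + nω with ω² + ω + 1 = 0. Then 1 + 3 `cosetNorm` p is the norm of 1 + (2 + ω)p,
where 2 + ω has norm 3; likewise 1 + 3 `coreNorm` p is the norm of 1 + 3p. -/
theorem admissible_cosetNorm : Admissible cosetNorm :=
  admissible_eisNorm.of_affine (f := fun p => (1 + 2 * p.1 - p.2, p.1 + p.2))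
    (by rintro ⟨a, b⟩ ⟨c, d⟩ h; simp only [Prod.mk.injEq] at h ⊢; omega) 1 3 (by norm_num)
    (by norm_num) (by rintro ⟨a, b⟩; simp only [cosetNorm, eisNorm]; ring)

theorem admissible_coreNorm : Admissible coreNorm :=
  admissible_eisNorm.of_affine (f := fun p => (1 + 3 * p.1, 3 * p.2))
    (by rintro ⟨a, b⟩ ⟨c, d⟩ h; simp only [Prod.mk.injEq] at h ⊢; omega) 1 3 (by norm_num)
    (by norm_num) (by rintro ⟨a, b⟩; simp only [coreNorm, eisNorm]; ring)

/-- The cubic theta function `a(q)`. -/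
noncomputable def thetaA : ℤ⟦X⟧ := genSeries eisNorm

/-- The cubic theta function `q^{-1/3} c(q)`. -/
noncomputable def thetaC : ℤ⟦X⟧ := genSeries cosetNorm

/-- The generating series of 3-cores. -/
noncomputable def coreSeries : ℤ⟦X⟧ := genSeries coreNorm

/-- The substitution `q ↦ q³`. -/
noncomputable abbrev cube : ℤ⟦X⟧ →ₐ[ℤ] ℤ⟦X⟧ := expand 3 three_ne_zero

theorem zmod_three_eq_zero {a : ℤ} : (a : ZMod 3) = 0 ↔ a % 3 = 0 := by
  rw [ZMod.intCast_zmod_eq_zero_iff_dvd]; omega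

theorem zmod_three_eq {a b : ℤ} : (a : ZMod 3) = b ↔ a % 3 = b % 3 :=
  ZMod.intCast_eq_intCast_iff' a b 3

/-- The residue of an integer modulo 3. -/
def residue (a : ℤ) : Fin 3 := Fin.ofNat 3 (a % 3).toNat

theorem residue_eq {a : ℤ} {i : Fin 3} : residue a = i ↔ a % 3 = i.val := by
  rw [Fin.ext_iff, residue, Fin.val_ofNat]
  have := i.isLt
  omega

/-- Multiplication by a cube root of unity on a nontrivial coset. -/
def rot (p : ℤ × ℤ) : ℤ × ℤ := (-p.2, p.1 - p.2 + 1)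

theorem cosetNorm_rot (p : ℤ × ℤ) : cosetNorm (rot p) = cosetNorm p := by
  simp only [rot, cosetNorm, eisNorm]; ring

theorem rot_bijective : Function.Bijective rot := by
  constructor
  · rintro ⟨a, b⟩ ⟨c, d⟩ h
    simp only [rot, Prod.mk.injEq] at h ⊢; omega
  · rintro ⟨a, b⟩
    exact ⟨(b - a - 1, -a), by simp only [rot, Prod.mk.injEq]; omega⟩

/-- The points 1 + (2 + ω)p fall into the classes of 1, ω, ω² modulo 3, and multiplication by ω,
which is `rot`, cycles these. Since (2 + ω)(1 - ω) = 3, the substitution of (1 - ω)p for p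
parametrizes the class 1 + 3p, whose weight is `coreNorm`. -/
theorem thetaC_eq : thetaC = 3 * coreSeries := by
  have := genSeries_cycle (β := ℤ × ℤ) admissible_cosetNorm rot rot_bijective cosetNorm_rot
    (fun p => ((p.1 + p.2 : ℤ) : ZMod 3)) (fun p => by
      have : ((1 : ℤ) : ZMod 3) = 1 := by norm_num
      rw [← this, ← Int.cast_add, zmod_three_eq]; simp only [rot]; omega)
    (fun p => (p.1 + p.2, 2 * p.2 - p.1))
    (by rintro ⟨a, b⟩ ⟨c, d⟩ h; simp only [Prod.mk.injEq] at h ⊢; omega)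
    (by rintro ⟨a, b⟩; rw [zmod_three_eq_zero]; omega)
    (by
      rintro ⟨a, b⟩ h
      rw [zmod_three_eq_zero] at h
      exact ⟨((2 * a - b) / 3, (a + b) / 3), by simp only [Prod.mk.injEq]; omega⟩)
  rw [thetaC, this, coreSeries]
  congr 1
  refine congrArg genSeries (funext ?_)
  rintro ⟨a, b⟩
  simp only [cosetNorm, coreNorm, eisNorm]; ring

theorem genSeries_one_add_three_cosetNorm :
    genSeries (fun p => 1 + 3 * cosetNorm p) = X * cube thetaC := by
  have := genSeries_const_add admissible_cosetNorm.three_mul 1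
  rw [genSeries_three_mul, pow_one] at this
  exact_mod_cast this

/-- Sort by residue modulo 2 + ω, which is m + n modulo 3 because ω ≡ 1. The zero class is the
multiples of 2 + ω; the other two are the points ±(1 + (2 + ω)p). -/
theorem thetaA_eq : thetaA = cube thetaA + 2 * (X * cube thetaC) := by
  have key := genSeries_cover (ι := Fin 3) (β := fun _ => ℤ × ℤ) admissible_eisNorm
    (![fun p => (2 * p.1 - p.2, p.1 + p.2), fun p => (1 + (2 * p.1 - p.2), p.1 + p.2),
      fun p => (-1 - (2 * p.1 - p.2), - (p.1 + p.2))])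
    (by
      intro i
      fin_cases i <;> rintro ⟨a, b⟩ ⟨c, d⟩ h <;> simp at h ⊢ <;> omega)
    (fun p => residue (p.1 + p.2))
    (by
      intro i
      fin_cases i <;> rintro ⟨a, b⟩ <;> rw [residue_eq] <;> simp <;> omega)
    (by
      rintro ⟨a, b⟩
      obtain h | h | h : (a + b) % 3 = 0 ∨ (a + b) % 3 = 1 ∨ (a + b) % 3 = 2 := by omega
      · rw [(residue_eq (i := 0)).2 h]
        exact ⟨((a + b) / 3, (2 * b - a) / 3), by simp; omega⟩
      · rw [(residue_eq (i := 1)).2 h]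
        exact ⟨((a - 1 + b) / 3, (2 * b - a + 1) / 3), by simp; omega⟩
      · rw [(residue_eq (i := 2)).2 h]
        exact ⟨((-1 - a - b) / 3, (1 + a - 2 * b) / 3), by simp; omega⟩)
  rw [Fin.sum_univ_three] at key
  have e0 : (fun p : ℤ × ℤ => eisNorm (2 * p.1 - p.2, p.1 + p.2)) = fun p => 3 * eisNorm p := by
    funext p; simp only [eisNorm]; ring
  have e1 : (fun p : ℤ × ℤ => eisNorm (1 + (2 * p.1 - p.2), p.1 + p.2)) =
      fun p => 1 + 3 * cosetNorm p := by
    funext p; simp only [eisNorm, cosetNorm]; ring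
  have e2 : (fun p : ℤ × ℤ => eisNorm (-1 - (2 * p.1 - p.2), - (p.1 + p.2))) =
      fun p => 1 + 3 * cosetNorm p := by
    funext p; simp only [eisNorm, cosetNorm]; ring
  simp only [Matrix.cons_val_zero, Matrix.cons_val_one, Matrix.cons_val, e0, e1, e2,
    genSeries_one_add_three_cosetNorm, genSeries_three_mul] at key
  rw [thetaA]
  linear_combination key

/-! ### The cubic identity by a Fourier transform on triples -/

/-- Triples of Eisenstein integers. -/
abbrev EisTriple : Type := (ℤ × ℤ) × (ℤ × ℤ) × (ℤ × ℤ)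

/-- The exponent of the cube of the 3-core series. -/
def coreTriple (t : EisTriple) : ℤ := coreNorm t.1 + (coreNorm t.2.1 + coreNorm t.2.2)

/-- The lattice change of variables on the class of triples with coordinate sum `0`. -/
def tripleZero (t : EisTriple) : EisTriple :=
  let x : ℤ × ℤ := (t.1.1 + t.2.1.1 + t.2.2.1 - t.2.2.2, t.2.2.2)
  (x, (x.1 + (t.2.1.2 - t.2.1.1) - t.2.2.1,
      x.2 - t.2.1.1 - (3 * t.2.2.2 - (t.1.1 + t.2.1.1 + t.2.2.1) - t.1.2 - t.2.1.2)),
    (x.1 - t.2.1.1 + (3 * t.2.2.2 - (t.1.1 + t.2.1.1 + t.2.2.1) - t.1.2 - t.2.1.2 - t.2.2.1),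
      x.2 - t.2.1.2 - t.2.2.1))

/-- Solve for the last coordinate so that the coordinate sum is divisible by `3`. -/
def fiberZero (t : EisTriple) : EisTriple :=
  (t.1, t.2.1, (t.2.2.1, 3 * t.2.2.2 - (t.1.1 + t.2.1.1 + t.2.2.1) - t.1.2 - t.2.1.2))

/-- By Parseval on ℤ/3, 1 + `coreTriple` (x, y, z) = N(1+x+y+z) + N(x+ωy+ω²z) + N(x+ω²y+ωz). Modulo
2 + ω the last two arguments are ≡ x+y+z and the first is one more, so the total coordinate sum
modulo 3 decides which are multiples of 2 + ω. For sum 0 they are 1 + (2+ω)p, (2+ω)q, (2+ω)r. -/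
theorem coreTriple_tripleZero (t : EisTriple) :
    1 + coreTriple (tripleZero t) =
      1 + 3 * cosetNorm (fiberZero t).1 +
        (3 * eisNorm (fiberZero t).2.1 + 3 * eisNorm (fiberZero t).2.2) := by
  simp only [coreTriple, tripleZero, fiberZero, coreNorm, cosetNorm, eisNorm]; ring

/-- The lattice change of variables on the class of triples with coordinate sum `1`. -/
def tripleOne (t : EisTriple) : EisTriple :=
  let x : ℤ × ℤ := (t.2.1.1 + t.2.2.1 - t.1.1 - t.2.2.2, t.2.2.2)
  (x, (x.1 + (t.2.1.2 - t.2.1.1) - t.2.2.1 - 1,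
      x.2 - t.2.1.1 - (3 * t.2.2.2 - (t.2.1.1 + t.2.2.1 - t.1.1) + t.1.2 - t.2.1.2)),
    (x.1 - t.2.1.1 + (3 * t.2.2.2 - (t.2.1.1 + t.2.2.1 - t.1.1) + t.1.2 - t.2.1.2 - t.2.2.1) - 1,
      x.2 - t.2.1.2 - t.2.2.1))

/-- Solve for the last coordinate so that the signed coordinate sum is divisible by `3`. -/
def fiberOne (t : EisTriple) : EisTriple :=
  (t.1, t.2.1, (t.2.2.1, 3 * t.2.2.2 - (t.2.1.1 + t.2.2.1 - t.1.1) + t.1.2 - t.2.1.2))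

/-- Here the transforms are -(1 + (2+ω)p), 1 + (2+ω)q, 1 + (2+ω)r. -/
theorem coreTriple_tripleOne (t : EisTriple) :
    1 + coreTriple (tripleOne t) =
      1 + 3 * cosetNorm (fiberOne t).1 +
        (1 + 3 * cosetNorm (fiberOne t).2.1 + (1 + 3 * cosetNorm (fiberOne t).2.2)) := by
  simp only [coreTriple, tripleOne, fiberOne, coreNorm, cosetNorm, eisNorm]; ring

/-- The lattice change of variables on the class of triples with coordinate sum `2`. -/
def tripleTwo (t : EisTriple) : EisTriple :=
  let x : ℤ × ℤ := (t.1.1 - t.2.1.1 - t.2.2.1 - t.2.2.2 - 1, t.2.2.2)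
  (x, (x.1 - (t.2.1.2 - t.2.1.1) + t.2.2.1 + 1,
      x.2 + t.2.1.1 + (t.1.1 - t.2.1.1 - t.2.2.1 - 3 * t.2.2.2 + t.1.2 - t.2.1.2)),
    (x.1 + t.2.1.1 - (t.1.1 - t.2.1.1 - t.2.2.1 - 3 * t.2.2.2 + t.1.2 - t.2.1.2 - t.2.2.1) + 1,
      x.2 + t.2.1.2 + t.2.2.1))

/-- Solve for the last coordinate so that the signed coordinate sum is divisible by `3`. -/
def fiberTwo (t : EisTriple) : EisTriple :=
  (t.1, t.2.1, (t.2.2.1, t.1.1 - t.2.1.1 - t.2.2.1 - 3 * t.2.2.2 + t.1.2 - t.2.1.2))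

/-- Here the transforms are (2+ω)p, -(1 + (2+ω)q), -(1 + (2+ω)r). -/
theorem coreTriple_tripleTwo (t : EisTriple) :
    1 + coreTriple (tripleTwo t) =
      3 * eisNorm (fiberTwo t).1 +
        (1 + 3 * cosetNorm (fiberTwo t).2.1 + (1 + 3 * cosetNorm (fiberTwo t).2.2)) := by
  simp only [coreTriple, tripleTwo, fiberTwo, coreNorm, cosetNorm, eisNorm]; ring

theorem admissible_coreTriple : Admissible coreTriple :=
  admissible_coreNorm.add (admissible_coreNorm.add admissible_coreNorm)

theorem genSeries_coreTriple :
    genSeries (fun t => 1 + coreTriple t) = X * coreSeries ^ 3 := by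
  have h1 := genSeries_mul admissible_coreNorm (admissible_coreNorm.add admissible_coreNorm)
  have h2 := genSeries_const_add admissible_coreTriple 1
  rw [genSeries_mul admissible_coreNorm admissible_coreNorm] at h1
  have h3 : genSeries coreTriple = coreSeries ^ 3 := by
    rw [coreSeries, pow_three]; exact h1
  rw [h3, pow_one] at h2
  exact_mod_cast h2

theorem genSeries_coreTriple_split :
    genSeries (fun t => 1 + coreTriple t) =
      genSeries (fun t => 1 + coreTriple (tripleZero t)) +
      genSeries (fun t => 1 + coreTriple (tripleOne t)) +
      genSeries (fun t => 1 + coreTriple (tripleTwo t)) := by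
  have key := genSeries_cover (ι := Fin 3) (β := fun _ => EisTriple)
    (w := fun t => 1 + coreTriple t)
    (by exact_mod_cast admissible_coreTriple.const_add 1)
    ![tripleZero, tripleOne, tripleTwo]
    (by
      intro i
      fin_cases i <;> rintro ⟨⟨p1, p2⟩, ⟨q1, q2⟩, r1, r2⟩ ⟨⟨p1', p2'⟩, ⟨q1', q2'⟩, r1', r2'⟩ h <;>
        simp [tripleZero, tripleOne, tripleTwo] at h ⊢ <;> omega)
    (fun t => residue (t.1.1 + t.1.2 + t.2.1.1 + t.2.1.2 + t.2.2.1 + t.2.2.2))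
    (by
      intro i
      fin_cases i <;> rintro ⟨⟨p1, p2⟩, ⟨q1, q2⟩, r1, r2⟩ <;> rw [residue_eq] <;>
        simp [tripleZero, tripleOne, tripleTwo] <;> omega)
    (by
      rintro ⟨⟨x1, x2⟩, ⟨y1, y2⟩, z1, z2⟩
      simp only
      obtain ⟨t, h | h | h⟩ : ∃ t, x1 + x2 + y1 + y2 + z1 + z2 = 3 * t ∨
          x1 + x2 + y1 + y2 + z1 + z2 = 3 * t + 1 ∨
          x1 + x2 + y1 + y2 + z1 + z2 = 3 * t + 2 :=
        ⟨(x1 + x2 + y1 + y2 + z1 + z2) / 3, by omega⟩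
      · rw [(residue_eq (i := 0)).2 (by simp; omega)]
        obtain ⟨p, hp⟩ : ∃ p : ℤ × ℤ, (2 * p.1 - p.2, p.1 + p.2) = (x1 + y1 + z1, x2 + y2 + z2) :=
          ⟨(t, x2 + y2 + z2 - t), by simp only [Prod.mk.injEq]; omega⟩
        obtain ⟨q, hq⟩ : ∃ q : ℤ × ℤ, (2 * q.1 - q.2, q.1 + q.2) =
            (x1 - y2 + z2 - z1, x2 + y1 - y2 - z1) :=
          ⟨(t - y2 - z1, x2 + y1 - t), by simp only [Prod.mk.injEq]; omega⟩
        obtain ⟨r, hr⟩ : ∃ r : ℤ × ℤ, (2 * r.1 - r.2, r.1 + r.2) =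
            (x1 + y2 - y1 - z2, x2 - y1 + z1 - z2) :=
          ⟨(t - y1 - z2, x2 + z1 - t), by simp only [Prod.mk.injEq]; omega⟩
        simp only [Prod.mk.injEq] at hp hq hr
        -- Inverting the transform, 3 x2 is the sum of all coordinates of p, q, r; hence x2 serves
        -- as a free parameter in place of r.2.
        exact ⟨(p, q, (r.1, x2)), by simp [tripleZero]; omega⟩
      · rw [(residue_eq (i := 1)).2 (by simp; omega)]
        obtain ⟨p, hp⟩ : ∃ p : ℤ × ℤ, (-2 - (2 * p.1 - p.2), - (p.1 + p.2)) =
            (x1 + y1 + z1, x2 + y2 + z2) :=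
          ⟨(- t - 1, t + 1 - (x2 + y2 + z2)), by simp only [Prod.mk.injEq]; omega⟩
        obtain ⟨q, hq⟩ : ∃ q : ℤ × ℤ, (1 + (2 * q.1 - q.2), q.1 + q.2) =
            (x1 - y2 + z2 - z1, x2 + y1 - y2 - z1) :=
          ⟨(t - y2 - z1, x2 + y1 - t), by simp only [Prod.mk.injEq]; omega⟩
        obtain ⟨r, hr⟩ : ∃ r : ℤ × ℤ, (1 + (2 * r.1 - r.2), r.1 + r.2) =
            (x1 + y2 - y1 - z2, x2 - y1 + z1 - z2) :=
          ⟨(t - y1 - z2, x2 + z1 - t), by simp only [Prod.mk.injEq]; omega⟩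
        simp only [Prod.mk.injEq] at hp hq hr
        exact ⟨(p, q, (r.1, x2)), by simp [tripleOne]; omega⟩
      · rw [(residue_eq (i := 2)).2 (by simp; omega)]
        obtain ⟨p, hp⟩ : ∃ p : ℤ × ℤ, (-1 + (2 * p.1 - p.2), p.1 + p.2) =
            (x1 + y1 + z1, x2 + y2 + z2) :=
          ⟨(t + 1, x2 + y2 + z2 - t - 1), by simp only [Prod.mk.injEq]; omega⟩
        obtain ⟨q, hq⟩ : ∃ q : ℤ × ℤ, (-1 - (2 * q.1 - q.2), -(q.1 + q.2)) =
            (x1 - y2 + z2 - z1, x2 + y1 - y2 - z1) :=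
          ⟨(-1 - (t - y2 - z1), 1 - (x2 + y1 - t)), by simp only [Prod.mk.injEq]; omega⟩
        obtain ⟨r, hr⟩ : ∃ r : ℤ × ℤ, (-1 - (2 * r.1 - r.2), -(r.1 + r.2)) =
            (x1 + y2 - y1 - z2, x2 - y1 + z1 - z2) :=
          ⟨(-1 - (t - y1 - z2), 1 - (x2 + z1 - t)), by simp only [Prod.mk.injEq]; omega⟩
        simp only [Prod.mk.injEq] at hp hq hr
        exact ⟨(p, q, (r.1, x2)), by simp [tripleTwo]; omega⟩)
  rw [Fin.sum_univ_three] at key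
  exact key

theorem admissible_three_mul_eisNorm : Admissible fun p => 3 * eisNorm p :=
  admissible_eisNorm.three_mul

theorem admissible_one_add_three_mul_cosetNorm : Admissible fun p => 1 + 3 * cosetNorm p := by
  exact_mod_cast admissible_cosetNorm.three_mul.const_add 1

theorem genSeries_three_mul_eisNorm : genSeries (fun p => 3 * eisNorm p) = cube thetaA :=
  genSeries_three_mul

theorem rot_map_bijective :
    Function.Bijective (fun t : EisTriple => ((rot t.1, t.2) : EisTriple)) ∧
      Function.Bijective (fun t : EisTriple => ((t.1, rot t.2.1, t.2.2) : EisTriple)) := by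
  constructor
  · exact rot_bijective.prodMap Function.bijective_id
  · exact Function.bijective_id.prodMap (rot_bijective.prodMap Function.bijective_id)

theorem intCast_eq_add_one {a b : ℤ} (h : a % 3 = (b + 1) % 3) : (a : ZMod 3) = b + 1 := by
  have := zmod_three_eq.2 h
  rw [this]; push_cast; rfl

/-- The triples hit by `fiberZero` are those with coordinate sum divisible by 3. Rotating the coset
component keeps the weight and adds 1 to that sum modulo 3, so they carry a third of the full
product. The other two classes work alike. -/
theorem three_mul_genSeries_tripleZero :
    3 * genSeries (fun t => 1 + coreTriple (tripleZero t)) =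
      X * cube thetaC * cube thetaA ^ 2 := by
  have h := genSeries_cycle (β := EisTriple) (admissible_one_add_three_mul_cosetNorm.add
    (admissible_three_mul_eisNorm.add admissible_three_mul_eisNorm))
    (fun t => (rot t.1, t.2)) rot_map_bijective.1
    (fun t => by simp only [cosetNorm_rot])
    (fun t => ((t.1.1 + t.1.2 + t.2.1.1 + t.2.1.2 + t.2.2.1 + t.2.2.2 : ℤ) : ZMod 3))
    (fun t => by apply intCast_eq_add_one; simp only [rot]; omega)
    fiberZero
    (by
      rintro ⟨⟨p1, p2⟩, ⟨q1, q2⟩, r1, r2⟩ ⟨⟨p1', p2'⟩, ⟨q1', q2'⟩, r1', r2'⟩ h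
      simp [fiberZero] at h ⊢; omega)
    (fun t => by rw [zmod_three_eq_zero]; simp only [fiberZero]; omega)
    (by
      rintro ⟨⟨p1, p2⟩, ⟨q1, q2⟩, r1, r2⟩ h
      rw [zmod_three_eq_zero] at h
      simp only at h
      exact ⟨((p1, p2), (q1, q2), r1, (p1 + p2 + q1 + q2 + r1 + r2) / 3), by
        simp [fiberZero]; omega⟩)
  rw [genSeries_mul admissible_one_add_three_mul_cosetNorm
    (admissible_three_mul_eisNorm.add admissible_three_mul_eisNorm),
    genSeries_mul admissible_three_mul_eisNorm admissible_three_mul_eisNorm,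
    genSeries_three_mul_eisNorm, genSeries_one_add_three_cosetNorm] at h
  simp only [coreTriple_tripleZero]
  rw [← h, sq]

theorem three_mul_genSeries_tripleOne :
    3 * genSeries (fun t => 1 + coreTriple (tripleOne t)) = (X * cube thetaC) ^ 3 := by
  have h := genSeries_cycle (β := EisTriple) (admissible_one_add_three_mul_cosetNorm.add
    (admissible_one_add_three_mul_cosetNorm.add admissible_one_add_three_mul_cosetNorm))
    (fun t => (t.1, rot t.2.1, t.2.2)) rot_map_bijective.2
    (fun t => by simp only [cosetNorm_rot])
    (fun t => ((- (t.1.1 + t.1.2) + t.2.1.1 + t.2.1.2 + t.2.2.1 + t.2.2.2 : ℤ) : ZMod 3))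
    (fun t => by apply intCast_eq_add_one; simp only [rot]; omega)
    fiberOne
    (by
      rintro ⟨⟨p1, p2⟩, ⟨q1, q2⟩, r1, r2⟩ ⟨⟨p1', p2'⟩, ⟨q1', q2'⟩, r1', r2'⟩ h
      simp [fiberOne] at h ⊢; omega)
    (fun t => by rw [zmod_three_eq_zero]; simp only [fiberOne]; omega)
    (by
      rintro ⟨⟨p1, p2⟩, ⟨q1, q2⟩, r1, r2⟩ h
      rw [zmod_three_eq_zero] at h
      simp only at h
      exact ⟨((p1, p2), (q1, q2), r1, (-(p1 + p2) + q1 + q2 + r1 + r2) / 3), by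
        simp [fiberOne]; omega⟩)
  rw [genSeries_mul admissible_one_add_three_mul_cosetNorm
    (admissible_one_add_three_mul_cosetNorm.add admissible_one_add_three_mul_cosetNorm),
    genSeries_mul admissible_one_add_three_mul_cosetNorm admissible_one_add_three_mul_cosetNorm,
    genSeries_one_add_three_cosetNorm] at h
  simp only [coreTriple_tripleOne]
  rw [← h, pow_three]

theorem three_mul_genSeries_tripleTwo :
    3 * genSeries (fun t => 1 + coreTriple (tripleTwo t)) =
      cube thetaA * (X * cube thetaC) ^ 2 := by
  have h := genSeries_cycle (β := EisTriple) (admissible_three_mul_eisNorm.add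
    (admissible_one_add_three_mul_cosetNorm.add admissible_one_add_three_mul_cosetNorm))
    (fun t => (t.1, rot t.2.1, t.2.2)) rot_map_bijective.2
    (fun t => by simp only [cosetNorm_rot])
    (fun t => ((- (t.1.1 + t.1.2) + t.2.1.1 + t.2.1.2 + t.2.2.1 + t.2.2.2 : ℤ) : ZMod 3))
    (fun t => by apply intCast_eq_add_one; simp only [rot]; omega)
    fiberTwo
    (by
      rintro ⟨⟨p1, p2⟩, ⟨q1, q2⟩, r1, r2⟩ ⟨⟨p1', p2'⟩, ⟨q1', q2'⟩, r1', r2'⟩ h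
      simp [fiberTwo] at h ⊢; omega)
    (fun t => by rw [zmod_three_eq_zero]; simp only [fiberTwo]; omega)
    (by
      rintro ⟨⟨p1, p2⟩, ⟨q1, q2⟩, r1, r2⟩ h
      rw [zmod_three_eq_zero] at h
      simp only at h
      exact ⟨((p1, p2), (q1, q2), r1, (p1 + p2 - q1 - q2 - r1 - r2) / 3), by
        simp [fiberTwo]; omega⟩)
  rw [genSeries_mul admissible_three_mul_eisNorm
    (admissible_one_add_three_mul_cosetNorm.add admissible_one_add_three_mul_cosetNorm),
    genSeries_mul admissible_one_add_three_mul_cosetNorm admissible_one_add_three_mul_cosetNorm,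
    genSeries_one_add_three_cosetNorm, genSeries_three_mul_eisNorm] at h
  simp only [coreTriple_tripleTwo]
  rw [← h, sq]

/-- The cubic identity of the Borweins in terms of 3-cores. -/
theorem coreSeries_cubed :
    3 * (X * coreSeries ^ 3) = X * cube thetaC *
      (cube thetaA ^ 2 + cube thetaA * (X * cube thetaC) + (X * cube thetaC) ^ 2) := by
  have h := genSeries_coreTriple_split
  rw [genSeries_coreTriple] at h
  linear_combination 3 * h + three_mul_genSeries_tripleZero + three_mul_genSeries_tripleOne +
    three_mul_genSeries_tripleTwo

/-! ### Root lattices and the theta series of A₈ -/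

/-- The root lattice `A_{k-1}`: integer vectors of length `k` with coordinate sum zero. -/
abbrev RootLattice (k : ℕ) : Type := {s : Fin k → ℤ // ∑ i, s i = 0}

/-- Half the square norm on the root lattice. -/
def rootNorm {k : ℕ} (s : RootLattice k) : ℤ := (∑ i, s.1 i ^ 2) / 2

theorem two_mul_rootNorm {k : ℕ} (s : RootLattice k) : 2 * rootNorm s = ∑ i, s.1 i ^ 2 := by
  have h : (2 : ℤ) ∣ ∑ i, s.1 i ^ 2 := by
    have : (2 : ℤ) ∣ ∑ i, (s.1 i ^ 2 - s.1 i) := Finset.dvd_sum fun i _ => by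
      have := Int.even_mul_pred_self (s.1 i)
      rw [show s.1 i ^ 2 - s.1 i = s.1 i * (s.1 i - 1) by ring]
      exact this.two_dvd
    rwa [Finset.sum_sub_distrib, s.2, sub_zero] at this
  exact Int.mul_ediv_cancel' h

theorem admissible_rootNorm (k : ℕ) : Admissible (rootNorm (k := k)) := by
  refine ⟨fun s => ?_, fun n => ?_⟩
  · have h1 := two_mul_rootNorm s
    have h2 : 0 ≤ ∑ i, s.1 i ^ 2 := Finset.sum_nonneg fun i _ => sq_nonneg _
    omega
  · have hb : ∀ s : {s : RootLattice k // rootNorm s = n}, ∀ i,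
        s.1.1 i ∈ Finset.Icc (-(2 * n)) (2 * n) := by
      intro s i
      have h1 := two_mul_rootNorm s.1
      have h2 : s.1.1 i ^ 2 ≤ ∑ i, s.1.1 i ^ 2 :=
        Finset.single_le_sum (f := fun i => s.1.1 i ^ 2) (fun j _ => sq_nonneg _)
          (Finset.mem_univ i)
      rw [← h1, s.2] at h2
      rw [Finset.mem_Icc]
      constructor <;> nlinarith [Int.le_self_sq (s.1.1 i), Int.le_self_sq (-s.1.1 i)]
    exact Finite.of_injective (fun s i =>
      (⟨s.1.1 i, hb s i⟩ : Finset.Icc (-(2 * n)) (2 * n))) fun s t h =>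
      Subtype.ext (Subtype.ext (funext fun i => congrArg Subtype.val (congrFun h i)))

/-- The theta series of the root lattice `A_{k-1}`. -/
noncomputable def rootTheta (k : ℕ) : ℤ⟦X⟧ := genSeries (rootNorm (k := k))

/-- The Eisenstein lattice as the root lattice `A₂`. -/
def eisRoot (p : ℤ × ℤ) : RootLattice 3 :=
  ⟨![p.2 - p.1, -p.2, p.1], by simp [Fin.sum_univ_three]; ring⟩

theorem eisRoot_bijective : Function.Bijective eisRoot := by
  constructor
  · rintro ⟨a, b⟩ ⟨c, d⟩ h
    have h0 := congrFun (congrArg Subtype.val h) 1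
    have h1 := congrFun (congrArg Subtype.val h) 2
    simp [eisRoot] at h0 h1
    simp only [Prod.mk.injEq]; omega
  · rintro ⟨s, hs⟩
    rw [Fin.sum_univ_three] at hs
    refine ⟨(s 2, -s 1), Subtype.ext (funext fun i => ?_)⟩
    fin_cases i <;> simp [eisRoot]
    omega

theorem rootTheta_three : rootTheta 3 = thetaA := by
  refine (genSeries_bijective eisRoot eisRoot_bijective.1 eisRoot_bijective.2 fun p => ?_).symm
  have := two_mul_rootNorm (eisRoot p)
  refine mul_left_cancel₀ (two_ne_zero (α := ℤ)) (this.trans ?_)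
  simp [Fin.sum_univ_three, eisRoot, eisNorm]
  ring

/-- Residues `0, 1, -1` modulo 3. -/
def sgn : Fin 3 → ℤ := ![0, 1, -1]

/-- The residue that makes three residues sum to zero modulo 3. -/
def sgnThird : Fin 3 × Fin 3 → ℤ := fun i => ![![0, -1, 1], ![-1, 1, 0], ![1, 0, -1]] i.1 i.2

/-- A third of the sum of the three residues. -/
def sgnCarry : Fin 3 × Fin 3 → ℤ := fun i => ![![0, 0, 0], ![0, 1, 0], ![0, 0, -1]] i.1 i.2

theorem sgn_sum (i : Fin 3 × Fin 3) : sgn i.1 + sgn i.2 + sgnThird i = 3 * sgnCarry i := by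
  revert i; decide

/-- Four Eisenstein integers. -/
abbrev EisQuadruple : Type := ((ℤ × ℤ) × (ℤ × ℤ)) × ((ℤ × ℤ) × (ℤ × ℤ))

/-- Coordinates on a class of vectors of `A₈` with given block sums modulo 3. -/
def rootNine (i : Fin 3 × Fin 3) (t : EisQuadruple) : RootLattice 9 :=
  ⟨![-t.2.2.1 - t.1.1.1, -t.2.2.1 + t.1.1.1 - t.1.1.2 + sgn i.1, -t.2.2.1 + t.1.1.2,
    t.2.2.1 - t.2.2.2 - sgnCarry i - t.1.2.1,
    t.2.2.1 - t.2.2.2 - sgnCarry i + t.1.2.1 - t.1.2.2 + sgn i.2,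
    t.2.2.1 - t.2.2.2 - sgnCarry i + t.1.2.2,
    t.2.2.2 - t.2.1.1, t.2.2.2 + t.2.1.1 - t.2.1.2 + sgnThird i, t.2.2.2 + t.2.1.2], by
    have := sgn_sum i
    simp [Fin.sum_univ_succ]
    omega⟩

/-- The exponent of the theta series of the coset with residue `r`. -/
def residueNorm (r : ℤ) (p : ℤ × ℤ) : ℤ := eisNorm p + r * (p.1 - p.2)

/-- Twice the exponent coming from the block sums. -/
def blockNorm (i : Fin 3 × Fin 3) (p : ℤ × ℤ) : ℤ :=
  3 * (p.1 ^ 2 + (p.1 - p.2 - sgnCarry i) ^ 2 + p.2 ^ 2) +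
    2 * (-p.1 * sgn i.1 + (p.1 - p.2 - sgnCarry i) * sgn i.2 + p.2 * sgnThird i) +
    (sgn i.1 ^ 2 + sgn i.2 ^ 2 + sgnThird i ^ 2)

/-- A block is (t, t, t) plus a vector v of sum s, with square norm 3t² + 2ts + Σv². Here Σv² = s² +
2 `residueNorm` s, so the three values of t separate from the three vectors v and are collected in
`blockNorm`. -/
theorem two_mul_rootNorm_rootNine (i : Fin 3 × Fin 3) (t : EisQuadruple) :
    2 * rootNorm (rootNine i t) =
      2 * (residueNorm (sgn i.1) t.1.1 + residueNorm (sgn i.2) t.1.2 +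
        residueNorm (sgnThird i) t.2.1) + blockNorm i t.2.2 := by
  rw [two_mul_rootNorm]
  simp [Fin.sum_univ_succ, rootNine, residueNorm, blockNorm, eisNorm]
  ring

theorem residue_block (i : Fin 3) (t : ℤ) : residue (3 * t + sgn i) = i := by
  rw [residue_eq]
  fin_cases i <;> simp [sgn]

theorem exists_block (a : ℤ) : ∃ t, a = 3 * t + sgn (residue a) := by
  obtain h | h | h : a % 3 = 0 ∨ a % 3 = 1 ∨ a % 3 = 2 := by omega
  · exact ⟨a / 3, by rw [(residue_eq (i := 0)).2 h]; simp [sgn]; omega⟩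
  · exact ⟨a / 3, by rw [(residue_eq (i := 1)).2 h]; simp [sgn]; omega⟩
  · exact ⟨a / 3 + 1, by rw [(residue_eq (i := 2)).2 h]; simp [sgn]; omega⟩

theorem rootTheta_nine_cover :
    rootTheta 9 = ∑ i, genSeries fun t => rootNorm (rootNine i t) := by
  refine genSeries_cover (admissible_rootNorm 9) rootNine (fun i => ?_)
    (fun s => (residue (s.1 0 + s.1 1 + s.1 2), residue (s.1 3 + s.1 4 + s.1 5)))
    (fun i t => ?_) (fun s => ?_)
  · rintro ⟨⟨⟨a1, a2⟩, b1, b2⟩, ⟨c1, c2⟩, d1, d2⟩ ⟨⟨⟨a1', a2'⟩, b1', b2'⟩, ⟨c1', c2'⟩, d1', d2'⟩ h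
    have h := fun j => congrFun (congrArg Subtype.val h) j
    have h0 := h 0; have h1 := h 1; have h2 := h 2; have h3 := h 3; have h4 := h 4
    have h5 := h 5; have h6 := h 6; have h7 := h 7; have h8 := h 8
    clear h
    simp [rootNine] at h0 h1 h2 h3 h4 h5 h6 h7 h8
    simp only [Prod.mk.injEq]
    omega
  · refine Prod.ext ?_ ?_
    · simp only [rootNine]
      refine Eq.trans (congrArg residue ?_) (residue_block i.1 (-t.2.2.1))
      simp; ring
    · simp only [rootNine]
      refine Eq.trans (congrArg residue ?_)
        (residue_block i.2 (t.2.2.1 - t.2.2.2 - sgnCarry i))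
      simp; ring
  · obtain ⟨s, hs⟩ := s
    simp only
    obtain ⟨t, ht⟩ := exists_block (s 0 + s 1 + s 2)
    obtain ⟨u, hu⟩ := exists_block (s 3 + s 4 + s 5)
    set i := (residue (s 0 + s 1 + s 2), residue (s 3 + s 4 + s 5)) with hi
    have h3 := sgn_sum i
    have e1 : sgn (residue (s 0 + s 1 + s 2)) = sgn i.1 := rfl
    have e2 : sgn (residue (s 3 + s 4 + s 5)) = sgn i.2 := rfl
    rw [e1] at ht
    rw [e2] at hu
    simp [Fin.sum_univ_succ] at hs
    refine ⟨(((t - s 0, s 2 - t), (u - s 3, s 5 - u)),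
      ((-t - u - sgnCarry i - s 6, s 8 - (-t - u - sgnCarry i)),
        (-t, -t - u - sgnCarry i))), Subtype.ext (funext fun j => ?_)⟩
    fin_cases j <;> simp [rootNine]
    all_goals omega

theorem residueNorm_zero : residueNorm 0 = eisNorm := by
  funext p; simp [residueNorm]

theorem residueNorm_one : residueNorm 1 = cosetNorm := by
  funext p; simp [residueNorm, cosetNorm]

theorem cosetNorm_neg (p : ℤ × ℤ) : cosetNorm (-p) = residueNorm (-1) p := by
  simp only [residueNorm, cosetNorm, eisNorm, Prod.fst_neg, Prod.snd_neg]; ring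

theorem genSeries_residueNorm_neg_one : genSeries (residueNorm (-1)) = thetaC :=
  genSeries_equiv (Equiv.neg _) cosetNorm_neg

theorem admissible_residueNorm {r : ℤ} (hr : r = 0 ∨ r = 1 ∨ r = -1) :
    Admissible (residueNorm r) := by
  obtain rfl | rfl | rfl := hr
  · rw [residueNorm_zero]; exact admissible_eisNorm
  · rw [residueNorm_one]; exact admissible_cosetNorm
  · have := admissible_cosetNorm.comp (neg_injective (G := ℤ × ℤ))
    simpa only [cosetNorm_neg] using this

theorem genSeries_rootNine (i : Fin 3 × Fin 3) {u : ℤ × ℤ → ℤ} (hu : Admissible u)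
    (g : ℤ × ℤ → ℤ × ℤ) (hg : Function.Bijective g) (h : ∀ p, blockNorm i p = 2 * u (g p)) :
    genSeries (fun t => rootNorm (rootNine i t)) =
      genSeries (residueNorm (sgn i.1)) * genSeries (residueNorm (sgn i.2)) *
        (genSeries (residueNorm (sgnThird i)) * genSeries u) := by
  have hs : ∀ j : Fin 3, sgn j = 0 ∨ sgn j = 1 ∨ sgn j = -1 := by decide
  have hs' : ∀ j, sgnThird j = 0 ∨ sgnThird j = 1 ∨ sgnThird j = -1 := by decide
  have a1 := admissible_residueNorm (hs i.1)
  have a2 := admissible_residueNorm (hs i.2)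
  have a3 := admissible_residueNorm (hs' i)
  have a4 := hu.comp hg.1
  rw [← genSeries_bijective (w := fun p => u (g p)) g hg.1 hg.2 fun _ => rfl,
    ← genSeries_mul a1 a2, ← genSeries_mul a3 a4, ← genSeries_mul (a1.add a2) (a3.add a4)]
  refine congrArg genSeries (funext fun t => ?_)
  have h1 := two_mul_rootNorm_rootNine i t
  have h2 := h t.2.2
  omega

theorem admissible_one_add_coreNorm : Admissible fun p => 1 + coreNorm p := by
  exact_mod_cast admissible_coreNorm.const_add 1

theorem genSeries_one_add_coreNorm : genSeries (fun p => 1 + coreNorm p) = X * coreSeries := by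
  have := genSeries_const_add admissible_coreNorm 1
  rw [pow_one] at this
  exact_mod_cast this

theorem admissible_two_add_cosetNorm : Admissible fun p => 2 + 3 * cosetNorm p := by
  exact_mod_cast admissible_cosetNorm.three_mul.const_add 2

theorem genSeries_two_add_cosetNorm :
    genSeries (fun p => 2 + 3 * cosetNorm p) = X ^ 2 * cube thetaC := by
  have := genSeries_const_add admissible_cosetNorm.three_mul 2
  rw [genSeries_three_mul] at this
  exact_mod_cast this

/-- The residues of the three block sums add to 0 modulo 3: they are all 0, or one of the six
orderings of 0, 1, -1, or all 1, or all -1. These give the three terms. -/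
theorem rootTheta_nine : rootTheta 9 = thetaA ^ 3 * cube thetaA +
    6 * (X * coreSeries * thetaA * thetaC ^ 2) + 2 * (X ^ 2 * cube thetaC * thetaC ^ 3) := by
  have hb : ∀ g : ℤ × ℤ → ℤ × ℤ, ∀ g', Function.LeftInverse g g' → Function.RightInverse g g' →
      Function.Bijective g' := fun g g' h1 h2 => ⟨h1.injective, h2.surjective⟩
  have h00 := genSeries_rootNine (0, 0) admissible_three_mul_eisNorm id Function.bijective_id
    (by intro p; simp [blockNorm, sgn, sgnThird, sgnCarry, eisNorm]; ring)
  have h01 := genSeries_rootNine (0, 1) admissible_one_add_coreNorm (fun p => (-p.2, -p.1))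
    (hb (fun p => (-p.2, -p.1)) _ (fun p => by simp) (fun p => by simp))
    (by intro p; simp [blockNorm, sgn, sgnThird, sgnCarry, coreNorm, eisNorm]; ring)
  have h02 := genSeries_rootNine (0, 2) admissible_one_add_coreNorm (fun p => (p.2, p.1))
    (hb (fun p => (p.2, p.1)) _ (fun p => by simp) (fun p => by simp))
    (by intro p; simp [blockNorm, sgn, sgnThird, sgnCarry, coreNorm, eisNorm]; ring)
  have h10 := genSeries_rootNine (1, 0) admissible_one_add_coreNorm (fun p => (-p.1, p.2 - p.1))
    (hb (fun p => (-p.1, p.2 - p.1)) _ (fun p => by simp) (fun p => by simp))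
    (by intro p; simp [blockNorm, sgn, sgnThird, sgnCarry, coreNorm, eisNorm]; ring)
  have h20 := genSeries_rootNine (2, 0) admissible_one_add_coreNorm (fun p => (p.1, p.1 - p.2))
    (hb (fun p => (p.1, p.1 - p.2)) _ (fun p => by simp) (fun p => by simp))
    (by intro p; simp [blockNorm, sgn, sgnThird, sgnCarry, coreNorm, eisNorm]; ring)
  have h12 := genSeries_rootNine (1, 2) admissible_one_add_coreNorm (fun p => (-p.1, -p.2))
    (hb (fun p => (-p.1, -p.2)) _ (fun p => by simp) (fun p => by simp))
    (by intro p; simp [blockNorm, sgn, sgnThird, sgnCarry, coreNorm, eisNorm]; ring)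
  have h21 := genSeries_rootNine (2, 1) admissible_one_add_coreNorm id Function.bijective_id
    (by intro p; simp [blockNorm, sgn, sgnThird, sgnCarry, coreNorm, eisNorm]; ring)
  have h11 := genSeries_rootNine (1, 1) admissible_two_add_cosetNorm (fun p => (-p.1, -p.2))
    (hb (fun p => (-p.1, -p.2)) _ (fun p => by simp) (fun p => by simp))
    (by intro p; simp [blockNorm, sgn, sgnThird, sgnCarry, cosetNorm, eisNorm]; ring)
  have h22 := genSeries_rootNine (2, 2) admissible_two_add_cosetNorm id Function.bijective_id
    (by intro p; simp [blockNorm, sgn, sgnThird, sgnCarry, cosetNorm, eisNorm]; ring)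
  rw [rootTheta_nine_cover, Fintype.sum_prod_type]
  simp only [Fin.sum_univ_three]
  rw [h00, h01, h02, h10, h11, h12, h20, h21, h22]
  simp only [sgn, sgnThird, Matrix.cons_val_zero, Matrix.cons_val_one, Matrix.cons_val,
    genSeries_residueNorm_neg_one, residueNorm_zero, residueNorm_one,
    genSeries_one_add_coreNorm, genSeries_two_add_cosetNorm, genSeries_three_mul_eisNorm]
  rw [← thetaA, ← thetaC]
  ring

/-! ### Fermionic states and the Jacobi triple product -/

/-- Remove the successor structure: a finite set of naturals is determined by whether it contains
`0` and by the shifted set of its positive elements. -/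
noncomputable def shiftEquiv : Finset ℕ ≃ Bool × Finset ℕ where
  toFun S := (decide (0 ∈ S), S.preimage Nat.succ Nat.succ_injective.injOn)
  invFun p := if p.1 then insert 0 (p.2.map ⟨Nat.succ, Nat.succ_injective⟩)
    else p.2.map ⟨Nat.succ, Nat.succ_injective⟩
  left_inv S := by
    ext a
    by_cases h : 0 ∈ S <;> cases a <;> simp [h]
  right_inv := by
    rintro ⟨b, S⟩
    cases b
    · refine Prod.ext (by simp) ?_
      ext a; simp
    · refine Prod.ext (by simp) ?_
      ext a; simp

theorem card_shiftEquiv_symm (b : Bool) (S : Finset ℕ) :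
    (shiftEquiv.symm (b, S)).card = S.card + b.toNat := by
  cases b <;> simp [shiftEquiv]

theorem sum_shiftEquiv_symm (b : Bool) (S : Finset ℕ) :
    ∑ a ∈ shiftEquiv.symm (b, S), (a : ℤ) = ∑ a ∈ S, (a : ℤ) + S.card := by
  cases b <;> simp [shiftEquiv, Finset.sum_add_distrib]

/-- The particle and hole sets of a fermionic state. -/
abbrev FermiState : Type := Finset ℕ × Finset ℕ

/-- The charge of a state. -/
def charge (x : FermiState) : ℤ := x.1.card - x.2.card

/-- Twice the energy of a state. -/
def energy (x : FermiState) : ℤ :=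
  2 * ∑ a ∈ x.1, (a : ℤ) + 2 * ∑ a ∈ x.2, (a : ℤ) + x.1.card + x.2.card

/-- The shift raising the charge by one. -/
noncomputable def raise : Equiv.Perm FermiState where
  toFun x := (shiftEquiv.symm (!(shiftEquiv x.2).1, x.1), (shiftEquiv x.2).2)
  invFun x := ((shiftEquiv x.1).2, shiftEquiv.symm (!(shiftEquiv x.1).1, x.2))
  left_inv x := by simp
  right_inv x := by simp

/-- Put particle a at level a + 1/2 and hole b at level -(b + 1/2). Then `raise` moves the whole
diagram up one level; level -1/2 becomes level 1/2, which is occupied exactly when there was no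
hole, whence the negated bit. -/
theorem charge_raise (x : FermiState) : charge (raise x) = charge x + 1 := by
  obtain ⟨S, T⟩ := x
  obtain ⟨⟨b, T⟩, rfl⟩ := shiftEquiv.symm.surjective T
  simp only [charge, raise, Equiv.coe_fn_mk, Equiv.apply_symm_apply, card_shiftEquiv_symm]
  cases b <;> simp <;> ring

theorem energy_raise (x : FermiState) : energy (raise x) = energy x + 2 * charge x + 1 := by
  obtain ⟨S, T⟩ := x
  obtain ⟨⟨b, T⟩, rfl⟩ := shiftEquiv.symm.surjective T
  simp only [charge, energy, raise, Equiv.coe_fn_mk, Equiv.apply_symm_apply,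
    card_shiftEquiv_symm, sum_shiftEquiv_symm]
  cases b <;> simp <;> ring

theorem charge_raise_zpow (n : ℤ) (x : FermiState) : charge ((raise ^ n) x) = charge x + n := by
  induction n using Int.induction_on generalizing x with
  | zero => simp
  | succ n ih =>
    rw [zpow_add_one, Equiv.Perm.mul_apply, ih, charge_raise]; ring
  | pred n ih =>
    have h := charge_raise (raise.symm x)
    rw [Equiv.apply_symm_apply] at h
    rw [zpow_sub_one, Equiv.Perm.mul_apply, ih]
    change charge (raise.symm x) + _ = _
    omega

theorem energy_raise_zpow (n : ℤ) (x : FermiState) :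
    energy ((raise ^ n) x) = energy x + 2 * n * charge x + n ^ 2 := by
  induction n using Int.induction_on generalizing x with
  | zero => simp
  | succ n ih =>
    rw [zpow_add_one, Equiv.Perm.mul_apply, ih, charge_raise, energy_raise]; ring
  | pred n ih =>
    have h := charge_raise (raise.symm x)
    have h' := energy_raise (raise.symm x)
    rw [Equiv.apply_symm_apply] at h h'
    rw [zpow_sub_one, Equiv.Perm.mul_apply, ih]
    change energy (raise.symm x) + 2 * _ * charge (raise.symm x) + _ = _
    rw [h, h']; ring

/-- States of charge zero. -/
abbrev NeutralState : Type := {x : FermiState // charge x = 0}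

/-- The energy of a state of charge zero. -/
def neutralEnergy (x : NeutralState) : ℤ :=
  ∑ a ∈ x.1.1, (a : ℤ) + ∑ a ∈ x.1.2, (a : ℤ) + x.1.1.card

theorem two_mul_neutralEnergy (x : NeutralState) : 2 * neutralEnergy x = energy x.1 := by
  have := x.2
  simp only [charge] at this
  simp only [neutralEnergy, energy]
  linarith

/-- The combinatorial form of the Jacobi triple product. -/
noncomputable def chargeEquiv : FermiState ≃ ℤ × NeutralState where
  toFun x := (charge x, ⟨(raise ^ (-charge x)) x, by rw [charge_raise_zpow]; ring⟩)
  invFun p := (raise ^ p.1) p.2.1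
  left_inv x := by
    simp only
    rw [← Equiv.Perm.mul_apply, ← zpow_add, add_neg_cancel, zpow_zero, Equiv.Perm.one_apply]
  right_inv := by
    rintro ⟨n, x, hx⟩
    have h : charge ((raise ^ n) x) = n := by rw [charge_raise_zpow, hx, zero_add]
    refine Prod.ext h (Subtype.ext ?_)
    simp only [h]
    rw [← Equiv.Perm.mul_apply, ← zpow_add, neg_add_cancel, zpow_zero, Equiv.Perm.one_apply]

theorem charge_chargeEquiv_symm (p : ℤ × NeutralState) : charge (chargeEquiv.symm p) = p.1 := by
  have := charge_raise_zpow p.1 p.2.1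
  rw [p.2.2, zero_add] at this
  exact this

theorem energy_chargeEquiv_symm (p : ℤ × NeutralState) :
    energy (chargeEquiv.symm p) = 2 * neutralEnergy p.2 + p.1 ^ 2 := by
  have := energy_raise_zpow p.1 p.2.1
  rw [p.2.2, ← two_mul_neutralEnergy, mul_zero, add_zero] at this
  exact this

/-- Tuples of states of total charge zero. -/
abbrev NeutralTuple (k : ℕ) : Type := {f : Fin k → FermiState // ∑ i, charge (f i) = 0}

/-- Separate the charges from a tuple of states. -/
noncomputable def tupleEquiv (k : ℕ) : RootLattice k × (Fin k → NeutralState) ≃ NeutralTuple k where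
  toFun p := ⟨fun i => chargeEquiv.symm (p.1.1 i, p.2 i), by
    simp only [charge_chargeEquiv_symm, p.1.2]⟩
  invFun f := (⟨fun i => charge (f.1 i), f.2⟩, fun i => (chargeEquiv (f.1 i)).2)
  left_inv p := by
    refine Prod.ext (Subtype.ext (funext fun i => ?_)) (funext fun i => ?_)
    · simp only [charge_chargeEquiv_symm]
    · simp only [Equiv.apply_symm_apply]
  right_inv f := by
    refine Subtype.ext (funext fun i => ?_)
    exact chargeEquiv.symm_apply_apply (f.1 i)

theorem charge_tupleEquiv {k : ℕ} (p : RootLattice k × (Fin k → NeutralState)) (i : Fin k) :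
    charge ((tupleEquiv k p).1 i) = p.1.1 i :=
  charge_chargeEquiv_symm _

theorem energy_tupleEquiv {k : ℕ} (p : RootLattice k × (Fin k → NeutralState)) (i : Fin k) :
    energy ((tupleEquiv k p).1 i) = 2 * neutralEnergy (p.2 i) + p.1.1 i ^ 2 :=
  energy_chargeEquiv_symm _

theorem admissible_neutralEnergy : Admissible neutralEnergy := by
  refine ⟨fun x => by unfold neutralEnergy; positivity, fun n => ?_⟩
  have hle : ∀ (S : Finset ℕ) a, a ∈ S → (a : ℤ) ≤ ∑ a ∈ S, (a : ℤ) := fun S a ha =>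
    Finset.single_le_sum (f := fun a : ℕ => (a : ℤ)) (fun _ _ => by positivity) ha
  have h0 : ∀ S : Finset ℕ, 0 ≤ ∑ a ∈ S, (a : ℤ) := fun S =>
    Finset.sum_nonneg fun _ _ => by positivity
  let B := (Finset.range (n.toNat + 1)).powerset
  refine Finite.of_injective (fun x : {x // neutralEnergy x = n} =>
    ((⟨x.1.1.1, ?_⟩, ⟨x.1.1.2, ?_⟩) : B × B)) ?_
  · rw [Finset.mem_powerset]
    intro a ha
    have h := x.2
    have h1 := hle _ _ ha
    have h2 := h0 x.1.1.2
    simp only [neutralEnergy] at h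
    rw [Finset.mem_range]; omega
  · rw [Finset.mem_powerset]
    intro a ha
    have h := x.2
    have h1 := hle _ _ ha
    have h2 := h0 x.1.1.1
    simp only [neutralEnergy] at h
    rw [Finset.mem_range]; omega
  · intro x y h
    exact Subtype.ext (Subtype.ext (Prod.ext (congrArg (fun t => t.1.1) h)
      (congrArg (fun t => t.2.1) h)))

/-- The generating series of neutral states. -/
noncomputable def neutralSeries : ℤ⟦X⟧ := genSeries neutralEnergy

theorem genSeries_tuple (k : ℕ) (w : NeutralTuple k → ℤ)
    (hw : ∀ f, 2 * w f = ∑ i, energy (f.1 i)) :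
    genSeries w = rootTheta k * neutralSeries ^ k := by
  have h := admissible_genSeries_pow admissible_neutralEnergy k
  rw [rootTheta, neutralSeries, ← h.2, ← genSeries_mul (admissible_rootNorm k) h.1]
  refine (genSeries_equiv (tupleEquiv k) fun p => ?_).symm
  have h1 := hw (tupleEquiv k p)
  simp only [energy_tupleEquiv, Finset.sum_add_distrib, ← Finset.mul_sum,
    ← two_mul_rootNorm] at h1
  omega

/-! ### Colour components and 3-quotients -/

/-- Pairs with the colour first, as pairs with the colour second. -/
def swapSigma (k : ℕ) : (Σ _ : Fin k, ℕ) ↪ ℕ × Fin k where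
  toFun q := (q.2, q.1)
  inj' := by
    rintro ⟨i, a⟩ ⟨j, b⟩ h
    simp only [Prod.mk.injEq] at h
    obtain ⟨rfl, rfl⟩ := h
    rfl

theorem swapSigma_apply {k : ℕ} (i : Fin k) (a : ℕ) : swapSigma k ⟨i, a⟩ = (a, i) := rfl

/-- A finite set of coloured naturals as a tuple of finite sets. -/
noncomputable def colorEquiv (k : ℕ) : Finset (ℕ × Fin k) ≃ (Fin k → Finset ℕ) where
  toFun S i := S.preimage (fun a => (a, i)) (Prod.mk_left_injective i).injOn
  invFun f := (Finset.univ.sigma f).map (swapSigma k)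
  left_inv S := by ext ⟨a, i⟩; simp [swapSigma_apply]
  right_inv f := by ext a i; simp [swapSigma_apply]

theorem sum_colorEquiv_symm {k : ℕ} (f : Fin k → Finset ℕ) (g : ℕ × Fin k → ℤ) :
    ∑ c ∈ (colorEquiv k).symm f, g c = ∑ i, ∑ a ∈ f i, g (a, i) := by
  simp [colorEquiv, Finset.sum_sigma, swapSigma_apply]

theorem sum_colorEquiv {k : ℕ} (S : Finset (ℕ × Fin k)) (g : ℕ × Fin k → ℤ) :
    ∑ c ∈ S, g c = ∑ i, ∑ a ∈ colorEquiv k S i, g (a, i) := by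
  rw [← sum_colorEquiv_symm, Equiv.symm_apply_apply]

/-- Division by three with remainder. -/
def divThree : ℕ ≃ ℕ × Fin 3 where
  toFun a := (a / 3, Fin.ofNat 3 a)
  invFun p := 3 * p.1 + p.2
  left_inv a := by simp [Nat.div_add_mod]
  right_inv p := by
    have := p.2.isLt
    refine Prod.ext ?_ (Fin.ext ?_)
    · simp; omega
    · simp

/-- The residue components of a finite set of naturals. -/
noncomputable def splitEquiv : Finset ℕ ≃ (Fin 3 → Finset ℕ) :=
  (Equiv.finsetCongr divThree).trans (colorEquiv 3)

theorem sum_splitEquiv (S : Finset ℕ) (g : ℕ → ℤ) :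
    ∑ a ∈ S, g a = ∑ i : Fin 3, ∑ a ∈ splitEquiv S i, g (3 * a + i) := by
  rw [splitEquiv, Equiv.trans_apply, ← sum_colorEquiv _ fun p => g (3 * p.1 + p.2)]
  simp [Equiv.finsetCongr, divThree, Nat.div_add_mod]

/-- The 3-quotient of a state. -/
noncomputable def quotientEquiv : FermiState ≃ (Fin 3 → FermiState) :=
  (splitEquiv.prodCongr (splitEquiv.trans (Equiv.arrowCongr Fin.revPerm (Equiv.refl _)))).trans
    (Equiv.arrowProdEquivProdArrow _ _ _).symm

/-- Hole b occupies slot -b - 1, of residue 2 - b modulo 3, so holes are indexed in reverse. -/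
theorem quotientEquiv_apply (x : FermiState) (i : Fin 3) :
    quotientEquiv x i = (splitEquiv x.1 i, splitEquiv x.2 i.rev) := rfl

theorem card_splitEquiv (S : Finset ℕ) :
    (S.card : ℤ) = ∑ i : Fin 3, ((splitEquiv S i).card : ℤ) := by
  have := sum_splitEquiv S fun _ => 1
  simpa using this

theorem charge_quotientEquiv (x : FermiState) :
    ∑ i, charge (quotientEquiv x i) = charge x := by
  simp only [charge, quotientEquiv_apply, card_splitEquiv x.1, card_splitEquiv x.2,
    Fin.sum_univ_three]
  simp [Fin.rev]
  ring

/-- In component i, particle 3a + i contributes 3(2a + 1) + 2(i - 1) and hole 3b + 2 - i contributes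
3(2b + 1) - 2(i - 1); the corrections add up to 2(i - 1) times the charge. -/
theorem energy_quotientEquiv (x : FermiState) :
    energy x = ∑ i, 3 * energy (quotientEquiv x i) +
      2 * (charge (quotientEquiv x 2) - charge (quotientEquiv x 0)) := by
  simp only [charge, energy, quotientEquiv_apply, card_splitEquiv x.1, card_splitEquiv x.2,
    sum_splitEquiv x.1, sum_splitEquiv x.2, Fin.sum_univ_three]
  simp [Fin.rev, Finset.sum_add_distrib, ← Finset.mul_sum]
  ring

/-- The 3-quotient of a neutral state. -/
noncomputable def neutralQuotientEquiv : NeutralState ≃ NeutralTuple 3 :=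
  quotientEquiv.subtypeEquiv fun x => by rw [charge_quotientEquiv]

/-- The charges of the 3-quotient form a vector of A₂, which encodes the 3-core and has weight
`coreNorm`; the three remaining neutral states have their energy tripled. -/
theorem neutralSeries_eq : neutralSeries = coreSeries * cube neutralSeries ^ 3 := by
  have h := admissible_genSeries_pow admissible_neutralEnergy.three_mul 3
  rw [genSeries_three_mul] at h
  rw [coreSeries, neutralSeries, ← h.2, ← genSeries_mul admissible_coreNorm h.1]
  let e : (ℤ × ℤ) × (Fin 3 → NeutralState) ≃ NeutralState :=
    (((Equiv.ofBijective eisRoot eisRoot_bijective).prodCongr (Equiv.refl _)).trans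
      (tupleEquiv 3)).trans neutralQuotientEquiv.symm
  refine (genSeries_equiv e fun p => ?_).symm
  have hq : quotientEquiv (e p).1 = (tupleEquiv 3 (eisRoot p.1, p.2)).1 :=
    congrArg Subtype.val (neutralQuotientEquiv.apply_symm_apply (tupleEquiv 3 (eisRoot p.1, p.2)))
  have h1 := energy_quotientEquiv (e p).1
  rw [← two_mul_neutralEnergy, hq, Fin.sum_univ_three] at h1
  simp only [energy_tupleEquiv, charge_tupleEquiv] at h1
  refine mul_left_cancel₀ (two_ne_zero (α := ℤ)) (h1.trans ?_)
  simp [eisRoot, coreNorm, eisNorm, Fin.sum_univ_three]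
  ring

/-! ### Frobenius partitions as neutral tuples -/

/-- A strictly decreasing row of coloured integers. -/
abbrev Row (k : ℕ) : Type := {l : List (ColoredNat k) // l.Pairwise (fun x y => x > y)}

/-- A decreasing row is determined by its set of entries. -/
noncomputable def rowEquiv (k : ℕ) : Row k ≃ Finset (ℕ × Fin k) where
  toFun l := l.1.toFinset.map ofLex.toEmbedding
  invFun S := ⟨(S.map toLex.toEmbedding).sort (· ≥ ·), Finset.sortedGT_sort _ |>.pairwise⟩
  left_inv l := by
    refine Subtype.ext ?_
    change ((l.1.toFinset.map ofLex.toEmbedding).map toLex.toEmbedding).sort (· ≥ ·) = l.1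
    refine List.Perm.eq_of_pairwise (le := fun x y => x > y)
      (fun a b _ _ hab hba => absurd hab (lt_asymm hba)) (Finset.sortedGT_sort _).pairwise l.2 ?_
    refine List.perm_of_nodup_nodup_toFinset_eq (Finset.sort_nodup _ _)
      (l.2.imp fun h => h.ne') ?_
    ext a
    simp
  right_inv S := by
    ext a
    simp

theorem sum_rowEquiv {k : ℕ} (l : Row k) (g : ColoredNat k → ℤ) :
    ∑ c ∈ rowEquiv k l, g (toLex c) = (l.1.map g).sum := by
  rw [← List.sum_toFinset g (l.2.imp fun h => h.ne')]
  simp [rowEquiv]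

/-- Pairs of rows as tuples of states. -/
noncomputable def rowsEquiv (k : ℕ) : Row k × Row k ≃ (Fin k → FermiState) :=
  (((rowEquiv k).trans (colorEquiv k)).prodCongr ((rowEquiv k).trans (colorEquiv k))).trans
    (Equiv.arrowProdEquivProdArrow _ _ _).symm

theorem length_row {k : ℕ} (l : Row k) :
    (l.1.length : ℤ) = ∑ i, ((colorEquiv k (rowEquiv k l) i).card : ℤ) := by
  have h1 := sum_rowEquiv l fun _ => 1
  have h2 := sum_colorEquiv (rowEquiv k l) fun _ => 1
  rw [h1] at h2
  simpa using h2

theorem sum_row {k : ℕ} (l : Row k) :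
    (((l.1.map ColoredNat.value).sum : ℕ) : ℤ) =
      ∑ i, ∑ a ∈ colorEquiv k (rowEquiv k l) i, (a : ℤ) := by
  have h1 := sum_rowEquiv l fun c => (c.value : ℤ)
  have h2 := sum_colorEquiv (rowEquiv k l) fun c => (ColoredNat.value (toLex c) : ℤ)
  rw [h1] at h2
  rw [Nat.cast_list_sum, List.map_map]
  exact h2

/-- A generalized Frobenius partition as a pair of rows. -/
def frobeniusRows (k : ℕ) : GenFrobeniusPartition k ≃
    {p : Row k × Row k // p.1.1.length = p.2.1.length} where
  toFun P := ⟨(⟨P.top, P.top_decreasing⟩, ⟨P.bottom, P.bottom_decreasing⟩), P.length_eq⟩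
  invFun p := ⟨p.1.1.1, p.1.2.1, p.2, p.1.1.2, p.1.2.2⟩
  left_inv _ := rfl
  right_inv _ := rfl

theorem sum_charge_rowsEquiv {k : ℕ} (p : Row k × Row k) :
    ∑ i, charge (rowsEquiv k p i) = p.1.1.length - p.2.1.length := by
  rw [length_row, length_row, ← Finset.sum_sub_distrib]
  rfl

/-- Generalized Frobenius partitions as neutral tuples of states. -/
noncomputable def frobeniusEquiv (k : ℕ) : GenFrobeniusPartition k ≃ NeutralTuple k :=
  (frobeniusRows k).trans ((rowsEquiv k).subtypeEquiv fun p => by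
    rw [sum_charge_rowsEquiv]; omega)

theorem two_mul_size {k : ℕ} (P : GenFrobeniusPartition k) :
    2 * (P.size : ℤ) = ∑ i, energy ((frobeniusEquiv k P).1 i) := by
  have h1 := length_row ⟨P.top, P.top_decreasing⟩
  have h2 := length_row ⟨P.bottom, P.bottom_decreasing⟩
  have h3 := sum_row ⟨P.top, P.top_decreasing⟩
  have h4 := sum_row ⟨P.bottom, P.bottom_decreasing⟩
  have h5 := P.length_eq
  simp only at h1 h2 h3 h4
  have h6 : ∑ i, energy ((frobeniusEquiv k P).1 i) =
      2 * ((P.top.map ColoredNat.value).sum : ℕ) + 2 * ((P.bottom.map ColoredNat.value).sum : ℕ) +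
        P.top.length + P.bottom.length := by
    rw [h1, h2, h3, h4, Finset.mul_sum, Finset.mul_sum, ← Finset.sum_add_distrib,
      ← Finset.sum_add_distrib, ← Finset.sum_add_distrib]
    rfl
  rw [h6, GenFrobeniusPartition.size]
  push_cast
  omega

/-- Andrews' generating series of `cφ_k`. -/
theorem genSeries_size (k : ℕ) :
    genSeries (fun P : GenFrobeniusPartition k => (P.size : ℤ)) =
      rootTheta k * neutralSeries ^ k := by
  rw [← genSeries_tuple k (fun f => (((frobeniusEquiv k).symm f).size : ℤ)) fun f => by
    rw [two_mul_size, Equiv.apply_symm_apply]]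
  exact genSeries_equiv (frobeniusEquiv k) fun P => by rw [Equiv.symm_apply_apply]

theorem cphi_natCast (k n : ℕ) :
    (cphi k n : ℤ) = coeff n (rootTheta k * neutralSeries ^ k) := by
  rw [← genSeries_size, genSeries, coeff_mk, cphi]
  congr 1
  exact Nat.card_congr (Equiv.subtypeEquivRight fun P => by norm_cast)

theorem cphi_eq_zero {k : ℕ} {x : ℚ} (h : ∀ n : ℕ, (n : ℚ) ≠ x) : cphi k x = 0 := by
  have : IsEmpty {P : GenFrobeniusPartition k // (P.size : ℚ) = x} := ⟨fun P => h _ P.2⟩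
  rw [cphi, Nat.card_of_isEmpty]

/-! ### Cubic theta identities and the product form of b -/

/-- A power series with constant term `1` and `F(q) = F(q³)³` equals `1`. -/
theorem eq_one_of_eq_cube_pow {F : ℤ⟦X⟧} (h0 : constantCoeff F = 1) (h : F = cube F ^ 3) :
    F = 1 := by
  by_contra hne
  have hG : F - 1 ≠ 0 := sub_ne_zero.2 hne
  -- F - 1 is a multiple of F(q³) - 1, so its order is at least three times itself, impossible for a
  -- finite positive order.
  have h1 : F - 1 = cube (F - 1) * (cube F ^ 2 + cube F + 1) := by
    rw [map_sub, map_one]; linear_combination h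
  have h2 : (F - 1).order = 3 • (F - 1).order + (cube F ^ 2 + cube F + 1).order := by
    conv_lhs => rw [h1]
    rw [order_mul, order_expand]
  have h3 : 1 ≤ (F - 1).order := by
    rw [one_le_order_iff_constCoeff_eq_zero, map_sub, h0, map_one, sub_self]
  have h4 : (F - 1).order ≠ ⊤ := by rwa [Ne, order_eq_top]
  obtain ⟨m, hm⟩ := ENat.ne_top_iff_exists.1 h4
  rw [← hm] at h2 h3
  have h5 : ((3 * m : ℕ) : ℕ∞) ≤ m := by
    rw [h2]
    push_cast
    rw [nsmul_eq_mul]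
    exact le_self_add
  have h6 : 3 * m ≤ m := by exact_mod_cast h5
  have h7 : 1 ≤ m := by exact_mod_cast h3
  omega

theorem coreSeries_cubed' : coreSeries ^ 3 = cube coreSeries *
    (cube thetaA ^ 2 + 3 * X * cube thetaA * cube coreSeries + 9 * X ^ 2 * cube coreSeries ^ 2) := by
  have h := coreSeries_cubed
  rw [thetaC_eq, map_mul, map_ofNat] at h
  have h3' : (3 : ℤ⟦X⟧) ≠ 0 := fun h0 => by
    have := congrArg constantCoeff h0
    rw [map_ofNat, map_zero] at this
    omega
  have hX : (3 * X : ℤ⟦X⟧) ≠ 0 := mul_ne_zero h3' X_ne_zero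
  refine mul_left_cancel₀ hX ?_
  linear_combination h

theorem thetaA_dissection : thetaA = cube thetaA + 6 * X * cube coreSeries := by
  have h := thetaA_eq
  rw [thetaC_eq, map_mul, map_ofNat] at h
  linear_combination h

theorem constantCoeff_genSeries {α : Type*} (w : α → ℤ) (a : α) (ha : ∀ b, w b = 0 ↔ b = a) :
    constantCoeff (genSeries w) = 1 := by
  rw [← coeff_zero_eq_constantCoeff_apply, genSeries, coeff_mk]
  have : Unique {b // w b = (0 : ℕ)} :=
    ⟨⟨⟨a, (ha a).2 rfl⟩⟩, fun b => Subtype.ext ((ha b.1).1 b.2)⟩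
  rw [Nat.card_unique]; rfl

theorem constantCoeff_thetaA : constantCoeff thetaA = 1 :=
  constantCoeff_genSeries _ 0 fun p => by
    constructor
    · obtain ⟨x, y⟩ := p
      intro h
      simp only [eisNorm] at h
      have h1 : x = 0 := by
        have : x ^ 2 = 0 := by nlinarith [sq_nonneg (x - 2 * y), sq_nonneg x]
        simpa using this
      have h2 : y = 0 := by subst h1; simpa using h
      rw [h1, h2]; rfl
    · rintro rfl; rfl

theorem constantCoeff_neutralSeries : constantCoeff neutralSeries = 1 :=
  constantCoeff_genSeries _ ⟨(∅, ∅), rfl⟩ fun x => by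
    constructor
    · intro h
      have h0 : ∀ S : Finset ℕ, 0 ≤ ∑ a ∈ S, (a : ℤ) := fun S =>
        Finset.sum_nonneg fun _ _ => by positivity
      have h1 := h0 x.1.1
      have h2 := h0 x.1.2
      have h3 := x.2
      simp only [neutralEnergy] at h
      simp only [charge] at h3
      exact Subtype.ext (Prod.ext (Finset.card_eq_zero.1 (by omega))
        (Finset.card_eq_zero.1 (by omega)))
    · rintro rfl; rfl

theorem constantCoeff_coreSeries : constantCoeff coreSeries = 1 := by
  have h := congrArg constantCoeff neutralSeries_eq
  simpa [constantCoeff_neutralSeries] using h.symm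

/-- The cubic identity `a³ - c³ = b³`. -/
theorem thetaA_cubed_sub :
    thetaA ^ 3 - 27 * X * coreSeries ^ 3 =
      (cube thetaA - 3 * X * cube coreSeries) ^ 3 := by
  have e := congrArg (· ^ 3) thetaA_dissection
  linear_combination e - 27 * X * coreSeries_cubed'

/-- The product form of `b(q)`. -/
theorem neutralSeries_cubed_mul :
    neutralSeries ^ 3 * (cube thetaA - 3 * X * cube coreSeries) = cube neutralSeries := by
  have e1 := neutralSeries_eq
  have e1' := congrArg (· ^ 3) e1
  have e2 := coreSeries_cubed'
  -- F is C P⁸ b³, expected to be 1. The factorization of a(q³)³ - 27q³C(q³)³ by b gives P³b =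
  -- P(q³)F(q³); cubing and using P = C P(q³)³ gives F = F(q³)³.
  set F := coreSeries * neutralSeries ^ 8 * (thetaA ^ 3 - 27 * X * coreSeries ^ 3) with hF
  have hcF : cube F = cube coreSeries * cube neutralSeries ^ 8 *
      (cube thetaA ^ 3 - 27 * X ^ 3 * cube coreSeries ^ 3) := by
    simp only [hF, map_mul, map_sub, map_pow, map_ofNat, expand_X]
  have hb : neutralSeries ^ 3 * (cube thetaA - 3 * X * cube coreSeries) =
      cube neutralSeries * cube F := by
    rw [hcF]
    linear_combination (cube thetaA - 3 * X * cube coreSeries) *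
      (e1' + cube neutralSeries ^ 9 * e2)
  have hb3 := congrArg (· ^ 3) hb
  have hH : cube neutralSeries ^ 3 ≠ 0 := fun h0 => by
    have := congrArg constantCoeff h0
    rw [map_pow, constantCoeff_expand, constantCoeff_neutralSeries, map_zero, one_pow] at this
    exact one_ne_zero this
  have hFF : F = cube F ^ 3 := by
    refine mul_left_cancel₀ hH ?_
    rw [← mul_pow, ← hb3, hF, thetaA_cubed_sub]
    linear_combination (-neutralSeries ^ 8 * (cube thetaA - 3 * X * cube coreSeries) ^ 3) * e1
  have h1 : F = 1 := eq_one_of_eq_cube_pow (by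
    simp [hF, constantCoeff_thetaA, constantCoeff_coreSeries, constantCoeff_neutralSeries]) hFF
  rw [hb, h1, map_one, mul_one]

theorem rootTheta_nine_mul :
    rootTheta 9 * neutralSeries ^ 9 =
      3 * (X * (27 * neutralSeries ^ 9 * coreSeries ^ 3 * thetaA)) +
        cube (rootTheta 3 * neutralSeries ^ 3) := by
  have h := congrArg (· ^ 3) neutralSeries_cubed_mul
  rw [rootTheta_nine, rootTheta_three, thetaC_eq, map_mul, map_mul, map_pow, map_ofNat, ← h,
    mul_pow (neutralSeries ^ 3), ← thetaA_cubed_sub]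
  linear_combination (-27 * X * coreSeries ^ 3 * neutralSeries ^ 9) * thetaA_dissection

/-! ### Dissection of cφ₃ and comparison of coefficients -/

/-- The 3-dissection of the generating series of `cφ₃`. -/
theorem rootTheta_three_mul :
    rootTheta 3 * neutralSeries ^ 3 =
      cube (neutralSeries ^ 9 * coreSeries * (thetaA ^ 3 + 54 * X * coreSeries ^ 3)) +
      X * cube (9 * neutralSeries ^ 9 * coreSeries ^ 2 * thetaA ^ 2) +
      X ^ 2 * cube (27 * neutralSeries ^ 9 * coreSeries ^ 3 * thetaA) := by
  have e1 := congrArg (· ^ 3) neutralSeries_eq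
  simp only [map_mul, map_add, map_pow, map_ofNat, expand_X]
  rw [rootTheta_three]
  linear_combination thetaA * e1 + thetaA * cube neutralSeries ^ 9 * coreSeries_cubed' +
    cube neutralSeries ^ 9 * cube coreSeries *
    (cube thetaA ^ 2 + 3 * X * cube thetaA * cube coreSeries + 9 * X ^ 2 * cube coreSeries ^ 2) *
    thetaA_dissection

theorem coeff_three_mul_add_two (m : ℕ) :
    coeff (3 * m + 2) (rootTheta 3 * neutralSeries ^ 3) =
      coeff m (27 * neutralSeries ^ 9 * coreSeries ^ 3 * thetaA) := by
  rw [rootTheta_three_mul, map_add, map_add, coeff_expand_of_not_dvd 3 _ _ (by omega),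
    coeff_succ_X_mul, coeff_expand_of_not_dvd 3 _ _ (by omega), coeff_X_pow_mul,
    coeff_expand_mul, zero_add, zero_add]

theorem cphi_three_shift (n : ℕ) :
    (cphi 3 (3 * (n : ℚ) - 1) : ℤ) =
      coeff n (X * (27 * neutralSeries ^ 9 * coreSeries ^ 3 * thetaA)) := by
  cases n with
  | zero =>
    -- At n = 0 the argument is -1, where cφ₃ vanishes, matching the zero constant term.
    rw [cphi_eq_zero fun m hm => ?_]
    · simp
    · have : (0 : ℚ) ≤ m := m.cast_nonneg
      push_cast at hm
      linarith
  | succ m =>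
    rw [coeff_succ_X_mul, ← coeff_three_mul_add_two, ← cphi_natCast]
    congr 2
    push_cast
    ring

theorem cphi_div_three (k n : ℕ) :
    (cphi k ((n : ℚ) / 3) : ℤ) = coeff n (cube (rootTheta k * neutralSeries ^ k)) := by
  rw [coeff_expand]
  split_ifs with h
  · obtain ⟨m, rfl⟩ := h
    rw [Nat.mul_div_cancel_left _ (by norm_num), ← cphi_natCast]
    congr 2
    push_cast
    ring
  · rw [cphi_eq_zero fun m hm => h ⟨m, ?_⟩, Nat.cast_zero]
    have h1 : (n : ℚ) = 3 * m := by rw [hm]; ring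
    exact_mod_cast h1

end FrobeniusSeries

theorem mainTheorem5 (n : ℤ) :
    cphi 9 (n : ℚ) = 3 * cphi 3 (3 * (n : ℚ) - 1) + cphi 3 ((n : ℚ) / 3) := by
  open FrobeniusSeries in
  obtain hn | hn := lt_or_ge n 0
  · have hq : (n : ℚ) < 0 := by exact_mod_cast hn
    have h0 : ∀ m : ℕ, (0 : ℚ) ≤ m := fun m => m.cast_nonneg
    rw [cphi_eq_zero fun m hm => ?_, cphi_eq_zero fun m hm => ?_, cphi_eq_zero fun m hm => ?_]
    all_goals have := h0 m; linarith
  · lift n to ℕ using hn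
    zify
    rw [cphi_natCast, rootTheta_nine_mul, cphi_three_shift, cphi_div_three,
      map_add]
    congr 1
    have h3 : (3 : ℤ⟦X⟧) = PowerSeries.C 3 := rfl
    rw [h3, coeff_C_mul]
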